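/- Let $\mathbb{K}$ be an algebraically closed field of characteristic zero and $n\ge 0$. Let $\bar{\mathrm U}(n)$ be the ring of fractions of $\mathbb{K}[\tilde h_1,\dots,\tilde h_n]$ with respect to the multiplicative set generated by the elements $\tilde h_{ij}+k$, $i\ne j$, $k\in\mathbb{Z}$, where $\tilde h_{ij}:=\tilde h_i-\tilde h_j$. Let $\mathrm{Diff}_{\mathbf h}(n)$ be the $\mathbb{K}$-algebra generated by $\bar{\mathrm U}(n)$ and elements $x^i,\bar\partial_i$, $1\le i\le n$, with the relations of $\bar{\mathrm U}(n)$ and $$\tilde h_ix^j=x^j(\tilde h_i+\delta_i^j),\qquad \tilde h_i\bar\partial_j=\bar\partial_j(\tilde h_i-\delta_i^j),$$ $$x^ix^j=\frac{\tilde h_{ij}+1}{\tilde h_{ij}}x^jx^i,\qquad \bar\partial_i\bar\partial_j=\frac{\tilde h_{ij}-1}{\tilde h_{ij}}\bar\partial_j\bar\partial_i\qquad(i<j),$$ $$x^i\bar\partial_j=\bar\partial_jx^i\ (i<j),\qquad x^i\bar\partial_j=\frac{\tilde h_{ij}(\tilde h_{ij}-2)}{(\tilde h_{ij}-1)^2}\bar\partial_jx^i\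 (i>j),\qquad x^i\bar\partial_i=\sum_{j}\frac{1}{1-\tilde h_{ij}}\bar\partial_jx^j-1 .$$ Put $\psi'_i:=\prod_{k<i}\tilde h_{ik}$ and $c_k:=\sum_j\frac{\partial e_k}{\partial\tilde h_j}\bar\partial_jx^j-e_k$, where $e_k$ is the $k$-th elementary symmetric polynomial in $\tilde h_1,\dots,\tilde h_n$. Let $\mathrm S_n\subset\mathrm{Diff}_{\mathbf h}(n)$ be the multiplicative set generated by the $x^j$ and the $\tilde h_{ij}+k$, $i\neq j$, $k\in\mathbb{Z}$. Let $\mathrm W_n$ be the Weyl algebra over $\mathbb{K}$ with generators $X^i,D_i$, $1\le i\le n$, and relations $X^iX^j=X^jX^i$, $D_iD_j=D_jD_i$, $D_iX^j=\delta_i^j+X^jD_i$, and let $\mathrm T\subset\mathrm W_n$ be the multiplicative set generated by the $X^j$ and the $X^jD_j-X^kD_k+\ell$, $j<k$, $\ell\in\mathbb{Z}$. Then $\mathrm S_n$ and $\mathrm T$ are left and right Ore sets in $\mathrm{Diff}_{\mathbf h}(n)$ and $\mathrm W_n$ respectively (that is, they satisfy the Ore condition and the corresponding reversibility condition on each side,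 so that the localizations exist), and there is an isomorphism of $\mathbb{K}$-algebras $$\mu\colon\ \mathbb{K}[a_1,\dots,a_n]\otimes_{\mathbb{K}}\mathrm T^{-1}\mathrm W_n\ \longrightarrow\ \mathrm S_n^{-1}\mathrm{Diff}_{\mathbf h}(n)$$ such that, for $i=1,\dots,n$, $$\mu(X^i)=x^i\psi'_i,\qquad \mu(D_i)=(\psi'_i)^{-1}\tilde h_i(x^i)^{-1},\qquad \mu(a_i)=c_i .$$ -/

import Mathlib

open scoped TensorProduct OreLocalization

noncomputable section

namespace HDeformed

/-! ### The coefficient ring -/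

/-- `U(n)`: the universal enveloping algebra of the abelian Lie algebra with basis
`h̃_1, …, h̃_n`, i.e. the polynomial ring in the `h̃_i`. -/
abbrev U (K : Type*) [Field K] (n : ℕ) : Type _ := MvPolynomial (Fin n) K

/-- The multiplicative set of denominators, generated by `h̃_i - h̃_j + k`, `i ≠ j`, `k ∈ ℤ`. -/
def denominators (K : Type*) [Field K] (n : ℕ) : Submonoid (U K n) :=
  Submonoid.closure
    {p | ∃ (i j : Fin n) (k : ℤ), i ≠ j ∧ p = MvPolynomial.X i - MvPolynomial.X j + (k : U K n)}

/-- `Ū(n)`: the ring of fractions of `U(n)` with denominators `h̃_i - h̃_j + k`. -/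
abbrev Ubar (K : Type*) [Field K] (n : ℕ) : Type _ := Localization (denominators K n)

/-- The element `h̃_i` of `Ū(n)`. -/
def h (K : Type*) [Field K] {n : ℕ} (i : Fin n) : Ubar K n :=
  algebraMap (U K n) (Ubar K n) (MvPolynomial.X i)

/-- The element `h̃_{ij} = h̃_i - h̃_j` of `Ū(n)`. -/
def hd (K : Type*) [Field K] {n : ℕ} (i j : Fin n) : Ubar K n := h K i - h K j

/-- For `i ≠ j` the elements `h̃_{ij} + k` are invertible in `Ū(n)`, so that `Ring.inverse` of
such an element is a true inverse. -/
theorem isUnit_hd_add (K : Type*) [Field K] {n : ℕ} {i j : Fin n} (hij : i ≠ j) (k : ℤ) :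
    IsUnit (hd K i j + (k : Ubar K n)) := by
  have hmem : (MvPolynomial.X i - MvPolynomial.X j + (k : U K n)) ∈ denominators K n :=
    Submonoid.subset_closure ⟨i, j, k, hij, rfl⟩
  have := IsLocalization.map_units (Ubar K n) ⟨_, hmem⟩
  simpa [hd, h] using this

/-- `ψ'_i = ∏_{k < i} h̃_{ik}`. -/
def psi' (K : Type*) [Field K] {n : ℕ} (i : Fin n) : Ubar K n :=
  ∏ k ∈ Finset.univ.filter (fun k => k < i), hd K i k

/-! ### The ring of `h`-deformed differential operators -/

/-- Symbols generating `Diff_h(n)`: the elements of `Ū(n)`, the `x^i` and the `∂̄_i`. -/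
inductive Gen (K : Type*) [Field K] (n : ℕ) : Type _
  | coeff (u : Ubar K n) : Gen K n
  | x (i : Fin n) : Gen K n
  | d (i : Fin n) : Gen K n

/-- The free algebra on the symbols. -/
abbrev FreeDiff (K : Type*) [Field K] (n : ℕ) : Type _ := FreeAlgebra K (Gen K n)

/-- The symbol of an element of `Ū(n)`. -/
def fu {K : Type*} [Field K] {n : ℕ} (u : Ubar K n) : FreeDiff K n :=
  FreeAlgebra.ι K (Gen.coeff u)

/-- The symbol `x^i`. -/
def fx (K : Type*) [Field K] {n : ℕ} (i : Fin n) : FreeDiff K n := FreeAlgebra.ι K (Gen.x i)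

/-- The symbol `∂̄_i`. -/
def fd (K : Type*) [Field K] {n : ℕ} (i : Fin n) : FreeDiff K n := FreeAlgebra.ι K (Gen.d i)

/-- The defining relations of `Diff_h(n)`: the first three say that `Ū(n)` maps to it by a
homomorphism of `K`-algebras, the next two are the weight relations, the others are the
quadratic-linear relations between the `x^i` and the `∂̄_j`. -/
inductive DiffRel (K : Type*) [Field K] (n : ℕ) : FreeDiff K n → FreeDiff K n → Prop
  | coeff_add (u v : Ubar K n) : DiffRel K n (fu (u + v)) (fu u + fu v)
  | coeff_mul (u v : Ubar K n) : DiffRel K n (fu (u * v)) (fu u * fu v)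
  | coeff_algebraMap (a : K) :
      DiffRel K n (fu (algebraMap K (Ubar K n) a)) (algebraMap K (FreeDiff K n) a)
  | weight_x (i j : Fin n) :
      DiffRel K n (fu (h K i) * fx K j) (fx K j * fu (h K i + if i = j then 1 else 0))
  | weight_d (i j : Fin n) :
      DiffRel K n (fu (h K i) * fd K j) (fd K j * fu (h K i - if i = j then 1 else 0))
  | x_x (i j : Fin n) (hij : i < j) :
      DiffRel K n (fx K i * fx K j)
        (fu ((hd K i j + 1) * Ring.inverse (hd K i j)) * (fx K j * fx K i))
  | d_d (i j : Fin n) (hij : i < j) :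
      DiffRel K n (fd K i * fd K j)
        (fu ((hd K i j - 1) * Ring.inverse (hd K i j)) * (fd K j * fd K i))
  | x_d_lt (i j : Fin n) (hij : i < j) : DiffRel K n (fx K i * fd K j) (fd K j * fx K i)
  | x_d_gt (i j : Fin n) (hij : j < i) :
      DiffRel K n (fx K i * fd K j)
        (fu (hd K i j * (hd K i j - 2) * Ring.inverse ((hd K i j - 1) ^ 2)) * (fd K j * fx K i))
  | x_d_eq (i : Fin n) :
      DiffRel K n (fx K i * fd K i)
        (∑ j, fu (Ring.inverse (1 - hd K i j)) * (fd K j * fx K j) - 1)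

/-- The ring `Diff_h(n)` of `h`-deformed differential operators of type A. -/
abbrev Diff (K : Type*) [Field K] (n : ℕ) : Type _ := RingQuot (DiffRel K n)

/-- The image of an element of `Ū(n)` in `Diff_h(n)`. -/
def ofU {K : Type*} [Field K] {n : ℕ} (u : Ubar K n) : Diff K n :=
  RingQuot.mkAlgHom K (DiffRel K n) (fu u)

/-- The generator `x^i` of `Diff_h(n)`. -/
def x (K : Type*) [Field K] {n : ℕ} (i : Fin n) : Diff K n :=
  RingQuot.mkAlgHom K (DiffRel K n) (fx K i)

/-- The generator `∂̄_i` of `Diff_h(n)`. -/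
def d (K : Type*) [Field K] {n : ℕ} (i : Fin n) : Diff K n :=
  RingQuot.mkAlgHom K (DiffRel K n) (fd K i)

/-- `Γ_i = ∂̄_i x^i`. -/
def Gam (K : Type*) [Field K] {n : ℕ} (i : Fin n) : Diff K n := d K i * x K i

/-- `c_k = ∑_j (∂e_k/∂h̃_j) Γ_j - e_k`, where `e_k` is the `k`-th elementary symmetric polynomial
in `h̃_1, …, h̃_n`. -/
def c (K : Type*) [Field K] (n k : ℕ) : Diff K n :=
  ∑ j, ofU (algebraMap (U K n) (Ubar K n)
      (MvPolynomial.pderiv j (MvPolynomial.esymm (Fin n) K k))) * Gam K j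
    - ofU (algebraMap (U K n) (Ubar K n) (MvPolynomial.esymm (Fin n) K k))

/-- `S_n`: the multiplicative set generated by the `x^j` and the `h̃_{ij} + k`, `i ≠ j`,
`k ∈ ℤ`. -/
def S (K : Type*) [Field K] (n : ℕ) : Submonoid (Diff K n) :=
  Submonoid.closure
    ({r | ∃ j : Fin n, r = x K j} ∪
      {r | ∃ (i j : Fin n) (k : ℤ), i ≠ j ∧ r = ofU (hd K i j + (k : Ubar K n))})

theorem x_mem_S (K : Type*) [Field K] {n : ℕ} (i : Fin n) : x K i ∈ S K n :=
  Submonoid.subset_closure (Or.inl ⟨i, rfl⟩)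

theorem ofU_mul {K : Type*} [Field K] {n : ℕ} (u v : Ubar K n) :
    ofU (u * v) = ofU u * ofU v := by
  simpa [ofU] using RingQuot.mkAlgHom_rel K (DiffRel.coeff_mul u v)

theorem ofU_one {K : Type*} [Field K] {n : ℕ} : ofU (1 : Ubar K n) = 1 := by
  simpa [ofU] using RingQuot.mkAlgHom_rel K (DiffRel.coeff_algebraMap (n := n) (1 : K))

theorem ofU_psi'_mem_S (K : Type*) [Field K] {n : ℕ} (i : Fin n) : ofU (psi' K i) ∈ S K n := by
  unfold psi'
  refine Finset.prod_induction _ (fun u => ofU u ∈ S K n) ?_ ?_ ?_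
  · intro a b ha hb
    rw [ofU_mul]
    exact mul_mem ha hb
  · rw [ofU_one]
    exact one_mem _
  · intro k hk
    refine Submonoid.subset_closure (Or.inr ⟨i, k, 0, ?_, by simp⟩)
    exact (Finset.mem_filter.mp hk).2.ne'

/-! ### The Weyl algebra -/

/-- Symbols generating the Weyl algebra `W_n`: the `X^i` and the `D_i`. -/
inductive WeylGen (n : ℕ) : Type
  | X (i : Fin n) : WeylGen n
  | D (i : Fin n) : WeylGen n

/-- The symbol `X^i`. -/
def wX (K : Type*) [Field K] {n : ℕ} (i : Fin n) : FreeAlgebra K (WeylGen n) :=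
  FreeAlgebra.ι K (WeylGen.X i)

/-- The symbol `D_i`. -/
def wD (K : Type*) [Field K] {n : ℕ} (i : Fin n) : FreeAlgebra K (WeylGen n) :=
  FreeAlgebra.ι K (WeylGen.D i)

/-- The defining relations of the Weyl algebra. -/
inductive WeylRel (K : Type*) [Field K] (n : ℕ) :
    FreeAlgebra K (WeylGen n) → FreeAlgebra K (WeylGen n) → Prop
  | X_X (i j : Fin n) : WeylRel K n (wX K i * wX K j) (wX K j * wX K i)
  | D_D (i j : Fin n) : WeylRel K n (wD K i * wD K j) (wD K j * wD K i)
  | D_X (i j : Fin n) :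
      WeylRel K n (wD K i * wX K j) ((if i = j then 1 else 0) + wX K j * wD K i)

/-- The Weyl algebra `W_n` of rank `n` over `K`. -/
abbrev Weyl (K : Type*) [Field K] (n : ℕ) : Type _ := RingQuot (WeylRel K n)

/-- The generator `X^i` of `W_n`. -/
def WX (K : Type*) [Field K] {n : ℕ} (i : Fin n) : Weyl K n :=
  RingQuot.mkAlgHom K (WeylRel K n) (wX K i)

/-- The generator `D_i` of `W_n`. -/
def WD (K : Type*) [Field K] {n : ℕ} (i : Fin n) : Weyl K n :=
  RingQuot.mkAlgHom K (WeylRel K n) (wD K i)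

/-- `T`: the multiplicative set generated by the `X^j D_j - X^k D_k + ℓ`, `j < k`, `ℓ ∈ ℤ`, and
the `X^j`. -/
def T (K : Type*) [Field K] (n : ℕ) : Submonoid (Weyl K n) :=
  Submonoid.closure
    ({r | ∃ j : Fin n, r = WX K j} ∪
      {r | ∃ (j k : Fin n) (l : ℤ), j < k ∧
        r = WX K j * WD K j - WX K k * WD K k + (l : Weyl K n)})

end HDeformed

end

set_option linter.unusedSectionVars false

namespace HDeformed

/-! ### Ore sets from generators -/

/-! Once the `x^i` are inverted, `∂̄_i = Γ_i (x^i)⁻¹`, so the localization is generated by `Ū(n)`,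
the `(x^i)^{±1}` and the pairwise commuting weight-zero elements `Γ_i` (`Gam_commute_Gam`). Two
changes of generators untangle it.

First, `X_i = x^i ψ'_i` commute with each other and still shift `h̃_i` by one (`torusData_diff`).
With `X_i D_i = h̃_i - 1` they generate, together with `Ū(n)`, a copy of the localized Weyl algebra.

Second, the `c_k` are affine in the `Γ_j` over `Ū(n)`, with matrix given by the coefficients of `F_j
= ∏_{i ≠ j} (z + h̃_i)`. Lagrange interpolation at the nodes `-h̃_k`, whose differences are units of
`Ū(n)`, inverts this matrix (`sum_lagCoeff_mul_coeff`, `sum_lagCoeff_mul_coeff_erase`), so the `Γ_j`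
may be replaced by the `c_k`. The `c_k` commute with each other, with `Ū(n)` and with the `x^j`
(`c_commute_x`), hence play the role of the polynomial variables `a_k`. Conversely, the
interpolation formula `gamOf` and `x^i = X_i (ψ'_i)⁻¹` satisfy the relations of `Diff_h(n)` inside
the tensor product (`TorusData.hDiffData`, `HDiffData.exists_diffHom`), which gives the inverse map.
No basis theorem for `Diff_h(n)` is needed: both composites are compared with the identity on
generators.

The Ore conditions need only be checked on generators. The `h̃_{ij} + k` are already units. For
`x^j`, every element is carried by a power of `x^j` into a finitely generated `Ū(n)`-module `V` with
`x^j V ⊆ V x^j`; this gives the Ore condition, and Noetherianity of `V` gives reversibility without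
knowing that `Diff_h(n)` is a domain. The same argument over `K` treats `X^j`. The elements `X^jD_j
- X^kD_k + ℓ` act ad-diagonalizably with integer eigenvalues, so a product of their integer shifts
does the job. The right-hand conditions are the left-hand ones in the opposite rings. -/

/-- Left Ore condition and left reversibility for a submonoid generated by a set need only be
checked on the generators. -/
theorem nonempty_oreSet_closure {R : Type*} [Ring R] (G : Set R)
    (hO : ∀ g ∈ G, ∀ r : R, ∃ s ∈ Submonoid.closure G, ∃ r', s * r = r' * g)
    (hR : ∀ g ∈ G, ∀ r : R, r * g = 0 → ∃ s ∈ Submonoid.closure G, s * r = 0) :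
    Nonempty (OreLocalization.OreSet (Submonoid.closure G)) := by
  have key : ∀ t ∈ Submonoid.closure G,
      (∀ r : R, ∃ s ∈ Submonoid.closure G, ∃ r', s * r = r' * t) ∧
      (∀ r : R, r * t = 0 → ∃ s ∈ Submonoid.closure G, s * r = 0) := by
    intro t ht
    induction ht using Submonoid.closure_induction with
    | mem g hg => exact ⟨hO g hg, hR g hg⟩
    | one => exact ⟨fun r => ⟨1, one_mem _, r, by simp⟩, fun r h => ⟨1, one_mem _, by simpa using h⟩⟩
    | mul a b _ _ ha hb =>
      refine ⟨fun r => ?_, fun r h => ?_⟩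
      · obtain ⟨s, hs, r', h⟩ := hb.1 r
        obtain ⟨s', hs', r'', h'⟩ := ha.1 r'
        exact ⟨s' * s, mul_mem hs' hs, r'', by rw [mul_assoc, h, ← mul_assoc, h', mul_assoc]⟩
      · obtain ⟨s, hs, h1⟩ := hb.2 (r * a) (by rw [mul_assoc, h])
        obtain ⟨s', hs', h2⟩ := ha.2 (s * r) (by rw [mul_assoc, h1])
        exact ⟨s' * s, mul_mem hs' hs, by rw [mul_assoc, h2]⟩
  rw [OreLocalization.nonempty_oreSet_iff]
  refine ⟨fun r₁ r₂ s h => ?_, fun r s => ?_⟩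
  · obtain ⟨t, ht, h'⟩ := (key s s.2).2 (r₁ - r₂) (by rw [sub_mul, h, sub_self])
    exact ⟨⟨t, ht⟩, by simpa [mul_sub, sub_eq_zero] using h'⟩
  · obtain ⟨t, ht, r', h'⟩ := (key s s.2).1 r
    exact ⟨r', ⟨t, ht⟩, h'⟩

/-! ### Adapted submodules: the Ore condition for the powers of one element -/

section Adapted

variable {B R : Type*} [CommRing B] [Ring R] [Module B R] [IsScalarTower B R R]

/-- A finitely generated left `B`-submodule `V` of a ring `R`, stable under right multiplication
by `B`, is adapted to `x` if `x V ⊆ V x`. -/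
structure Adapted (x : R) (V : Submodule B R) : Prop where
  fg : V.FG
  right : ∀ v ∈ V, ∀ b : B, v * (b • (1 : R)) ∈ V
  shift : ∀ v ∈ V, ∃ v' ∈ V, x * v = v' * x

theorem Adapted.shift_pow {x : R} {V : Submodule B R} (hV : Adapted x V) (m : ℕ) :
    ∀ v ∈ V, ∃ v' ∈ V, x ^ m * v = v' * x ^ m := by
  induction m with
  | zero => exact fun v hv => ⟨v, hv, by simp⟩
  | succ m ih =>
    intro v hv
    obtain ⟨v', hv', h⟩ := hV.shift v hv
    obtain ⟨v'', hv'', h'⟩ := ih v' hv'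
    exact ⟨v'', hv'', by rw [pow_succ, mul_assoc, h, ← mul_assoc, h', mul_assoc]⟩

theorem Adapted.sup {x : R} {V W : Submodule B R} (hV : Adapted x V) (hW : Adapted x W) :
    Adapted x (V ⊔ W) where
  fg := hV.fg.sup hW.fg
  right := by
    intro v hv b
    obtain ⟨v, hv', w, hw, rfl⟩ := Submodule.mem_sup.1 hv
    rw [add_mul]
    exact Submodule.add_mem_sup (hV.right v hv' b) (hW.right w hw b)
  shift := by
    intro v hv
    obtain ⟨v, hv', w, hw, rfl⟩ := Submodule.mem_sup.1 hv
    obtain ⟨v', hv', h⟩ := hV.shift v hv'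
    obtain ⟨w', hw', h'⟩ := hW.shift w hw
    exact ⟨v' + w', Submodule.add_mem_sup hv' hw', by rw [mul_add, h, h', add_mul]⟩

/-- Span of a finite set of normalizing elements. -/
theorem adapted_span {x : R} (F : Set R) (hF : F.Finite)
    (hB : ∀ b : B, ∃ b' : B, x * (b • (1 : R)) = b' • x)
    (h1 : ∀ v ∈ F, ∀ b : B, v * (b • (1 : R)) ∈ Submodule.span B F)
    (h2 : ∀ v ∈ F, ∃ v' ∈ Submodule.span B F, x * v = v' * x) :
    Adapted x (Submodule.span B F) where
  fg := Submodule.fg_span hF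
  right := by
    intro v hv b
    induction hv using Submodule.span_induction with
    | mem v hv => exact h1 v hv b
    | zero => simp
    | add v w _ _ hv hw => rw [add_mul]; exact add_mem hv hw
    | smul a v _ hv => rw [smul_mul_assoc]; exact Submodule.smul_mem _ _ hv
  shift := by
    intro v hv
    induction hv using Submodule.span_induction with
    | mem v hv => exact h2 v hv
    | zero => exact ⟨0, zero_mem _, by simp⟩
    | add v w _ _ hv hw =>
      obtain ⟨v', hv', h⟩ := hv
      obtain ⟨w', hw', h'⟩ := hw
      exact ⟨v' + w', add_mem hv' hw', by rw [mul_add, h, h', add_mul]⟩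
    | smul a v _ hv =>
      obtain ⟨v', hv', h⟩ := hv
      obtain ⟨b, hb⟩ := hB a
      refine ⟨b • v', Submodule.smul_mem _ _ hv', ?_⟩
      calc x * a • v = (x * (a • (1 : R))) * v := by rw [mul_assoc, smul_mul_assoc, one_mul]
        _ = b • v' * x := by rw [hb, smul_mul_assoc, h, smul_mul_assoc]

theorem adapted_span_singleton {x v : R}
    (hB : ∀ b : B, ∃ b' : B, x * (b • (1 : R)) = b' • x)
    (h1 : ∀ b : B, ∃ b' : B, v * (b • (1 : R)) = b' • v)
    (h2 : ∃ b : B, x * v = b • (v * x)) : Adapted x (Submodule.span B {v}) := by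
  refine adapted_span _ (Set.finite_singleton v) hB ?_ ?_
  · rintro _ rfl b
    obtain ⟨b', hb'⟩ := h1 b
    rw [hb']
    exact Submodule.smul_mem _ _ (Submodule.mem_span_singleton_self _)
  · rintro _ rfl
    obtain ⟨b, hb⟩ := h2
    exact ⟨b • _, Submodule.smul_mem _ _ (Submodule.mem_span_singleton_self _),
      by rw [hb, smul_mul_assoc]⟩

/-- The products of generators span the required module: right stability of `V` lets a scalar
standing between the factors be absorbed on the left, `v (b w) = (v b) w`. -/
theorem Adapted.mul {x : R} {V W : Submodule B R} (hV : Adapted x V) (hW : Adapted x W)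
    (hB : ∀ b : B, ∃ b' : B, x * (b • (1 : R)) = b' • x) :
    ∃ U : Submodule B R, Adapted x U ∧ ∀ v ∈ V, ∀ w ∈ W, v * w ∈ U := by
  obtain ⟨F, hF, rfl⟩ := Submodule.fg_def.1 hV.fg
  obtain ⟨G, hG, rfl⟩ := Submodule.fg_def.1 hW.fg
  set U := Submodule.span B (Set.image2 (· * ·) F G)
  have hm1 : ∀ v ∈ Submodule.span B F, ∀ w ∈ G, v * w ∈ U := by
    intro v hv w hw
    induction hv using Submodule.span_induction with
    | mem v hv => exact Submodule.subset_span ⟨v, hv, w, hw, rfl⟩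
    | zero => simp
    | add v w _ _ hv hw => rw [add_mul]; exact add_mem hv hw
    | smul a v _ hv => rw [smul_mul_assoc]; exact Submodule.smul_mem _ _ hv
  have hm : ∀ w ∈ Submodule.span B G, ∀ v ∈ Submodule.span B F, v * w ∈ U := by
    intro w hw
    induction hw using Submodule.span_induction with
    | mem w hw => exact fun v hv => hm1 v hv w hw
    | zero => simp
    | add w w' _ _ hw hw' => intro v hv; rw [mul_add]; exact add_mem (hw v hv) (hw' v hv)
    | smul a w _ hw =>
      intro v hv
      have : v * a • w = (v * (a • (1 : R))) * w := by rw [mul_assoc, smul_mul_assoc, one_mul]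
      rw [this]
      exact hw _ (hV.right v hv a)
  refine ⟨U, adapted_span _ (hF.image2 _ hG) hB ?_ ?_, fun v hv w hw => hm w hw v hv⟩
  · rintro _ ⟨v, hv, w, hw, rfl⟩ b
    rw [mul_assoc]
    exact hm _ (hW.right w (Submodule.subset_span hw) b) _ (Submodule.subset_span hv)
  · rintro _ ⟨v, hv, w, hw, rfl⟩
    obtain ⟨v', hv', h⟩ := hV.shift v (Submodule.subset_span hv)
    obtain ⟨w', hw', h'⟩ := hW.shift w (Submodule.subset_span hw)
    exact ⟨v' * w', hm _ hw' _ hv', by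
      simp only
      rw [← mul_assoc, h, mul_assoc, h', mul_assoc]⟩

variable (B) in
/-- Elements `r` that some power of `x` moves into a submodule adapted to `x`. -/
def AdaptedElem (x r : R) : Prop :=
  ∃ (m : ℕ) (V : Submodule B R), Adapted x V ∧ x ^ m * r ∈ V

theorem Adapted.adaptedElem {x r : R} {V : Submodule B R} (hV : Adapted x V) (hr : r ∈ V) :
    AdaptedElem B x r := ⟨0, V, hV, by simpa using hr⟩

/-- The power needed for `r₂` is pushed through the vector `x ^ m₁ * r₁` of `V₁`, since `x ^ m₂ V₁ ⊆
V₁ x ^ m₂`. Exponents therefore add. -/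
theorem AdaptedElem.mul {x r₁ r₂ : R} (hB : ∀ b : B, ∃ b' : B, x * (b • (1 : R)) = b' • x)
    (h₁ : AdaptedElem B x r₁) (h₂ : AdaptedElem B x r₂) : AdaptedElem B x (r₁ * r₂) := by
  obtain ⟨m₁, V₁, hV₁, h₁⟩ := h₁
  obtain ⟨m₂, V₂, hV₂, h₂⟩ := h₂
  obtain ⟨U, hU, hm⟩ := hV₁.mul hV₂ hB
  obtain ⟨v, hv, h⟩ := hV₁.shift_pow m₂ _ h₁
  refine ⟨m₂ + m₁, U, hU, ?_⟩
  have : x ^ (m₂ + m₁) * (r₁ * r₂) = v * (x ^ m₂ * r₂) := by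
    rw [pow_add, ← mul_assoc v, ← h]; simp only [mul_assoc]
  rw [this]
  exact hm _ hv _ h₂

theorem adapted_span_pow {x : R} (hB : ∀ b : B, ∃ b' : B, x * (b • (1 : R)) = b' • x) (k : ℕ) :
    Adapted x (Submodule.span B {x ^ k}) := by
  refine adapted_span_singleton hB ?_ ⟨1, by rw [one_smul, ← pow_succ, ← pow_succ']⟩
  induction k with
  | zero => exact fun b => ⟨b, by simp⟩
  | succ k ih =>
    intro b
    obtain ⟨b', hb'⟩ := hB b
    obtain ⟨b'', hb''⟩ := ih b'
    refine ⟨b'', ?_⟩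
    have : b' • x = (b' • (1 : R)) * x := by rw [smul_mul_assoc, one_mul]
    rw [pow_succ, mul_assoc, hb', this, ← mul_assoc, hb'', smul_mul_assoc]

/-- The exponents of the summands have to be equalized. Further powers of `x` leave `V` but land in
`V x ^ k`, which lies in the product of `V` with the adapted module `B x ^ k`. -/
theorem AdaptedElem.add {x r₁ r₂ : R} (hB : ∀ b : B, ∃ b' : B, x * (b • (1 : R)) = b' • x)
    (h₁ : AdaptedElem B x r₁) (h₂ : AdaptedElem B x r₂) : AdaptedElem B x (r₁ + r₂) := by
  have shift : ∀ (m k : ℕ) (V : Submodule B R) (r : R), Adapted x V → x ^ m * r ∈ V →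
      ∃ U : Submodule B R, Adapted x U ∧ x ^ (k + m) * r ∈ U := by
    intro m k V r hV hr
    obtain ⟨U, hU, hm⟩ := hV.mul (adapted_span_pow hB k) hB
    obtain ⟨v, hv, h⟩ := hV.shift_pow k _ hr
    refine ⟨U, hU, ?_⟩
    rw [pow_add, mul_assoc, h]
    exact hm _ hv _ (Submodule.mem_span_singleton_self _)
  obtain ⟨m₁, V₁, hV₁, h₁⟩ := h₁
  obtain ⟨m₂, V₂, hV₂, h₂⟩ := h₂
  obtain ⟨U₁, hU₁, h₁⟩ := shift m₁ m₂ V₁ r₁ hV₁ h₁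
  obtain ⟨U₂, hU₂, h₂⟩ := shift m₂ m₁ V₂ r₂ hV₂ h₂
  refine ⟨m₂ + m₁, U₁ ⊔ U₂, hU₁.sup hU₂, ?_⟩
  rw [mul_add]
  exact Submodule.add_mem_sup h₁ (by rwa [add_comm])

theorem AdaptedElem.exists_pow_mul_eq {x r : R} (h : AdaptedElem B x r) :
    ∃ (m : ℕ) (r' : R), x ^ m * r = r' * x := by
  obtain ⟨m, V, hV, h⟩ := h
  obtain ⟨v, -, h'⟩ := hV.shift _ h
  exact ⟨m + 1, v, by rw [pow_succ', mul_assoc, h']⟩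

/-- Reversibility: the submodules `{v ∈ V | v x ^ m = 0}` form an ascending chain in a Noetherian
module. -/
theorem AdaptedElem.exists_pow_mul_eq_zero [IsNoetherianRing B] {x r : R}
    (h : AdaptedElem B x r) (hr : r * x = 0) : ∃ m : ℕ, x ^ m * r = 0 := by
  obtain ⟨k, V, hV, h⟩ := h
  have : IsNoetherian B V := isNoetherian_of_fg_of_noetherian V hV.fg
  let A : ℕ →o Submodule B V :=
    { toFun := fun m =>
        { carrier := {v | (v : R) * x ^ m = 0}
          zero_mem' := by simp
          add_mem' := by
            intro a b ha hb
            simp only [Set.mem_ofPred_eq] at ha hb ⊢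
            rw [Submodule.coe_add, add_mul, ha, hb, add_zero]
          smul_mem' := by
            intro c a ha
            simp only [Set.mem_ofPred_eq] at ha ⊢
            rw [Submodule.coe_smul, smul_mul_assoc, ha, smul_zero] }
      monotone' := by
        intro a b hab v hv
        obtain ⟨c, rfl⟩ := Nat.exists_eq_add_of_le hab
        change (v : R) * x ^ a = 0 at hv
        change (v : R) * x ^ (a + c) = 0
        rw [pow_add, ← mul_assoc, hv, zero_mul] }
  -- With `m` past stabilization, write `x ^ m (x ^ k r) = v x ^ m`. Then `v x ^ (m + 1) = x ^ (m +
  -- k) r x = 0`, so already `v x ^ m = 0`.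
  obtain ⟨m, hm⟩ := monotone_stabilizes_iff_noetherian.2 this A
  obtain ⟨v, hv, h'⟩ := hV.shift_pow m _ h
  have h1 : (⟨v, hv⟩ : V) ∈ A (m + 1) := by
    change v * x ^ (m + 1) = 0
    rw [pow_succ, ← mul_assoc, ← h', mul_assoc, mul_assoc, hr, mul_zero, mul_zero]
  rw [← hm (m + 1) (Nat.le_succ m)] at h1
  have h2 : v * x ^ m = 0 := h1
  exact ⟨m + k, by rw [pow_add, mul_assoc, h', h2]⟩

end Adapted

/-! ### Ad-diagonalizable elements: the Ore condition up to integer shifts -/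

section Diagonalizable

variable {R : Type*} [Ring R]

/-- The eigenvectors of `ad t` with integer eigenvalues. -/
def adEigen (t : R) : Submonoid R where
  carrier := {v | ∃ w : ℤ, t * v = v * (t + (w : R))}
  one_mem' := ⟨0, by simp⟩
  mul_mem' := by
    rintro a b ⟨v, hv⟩ ⟨w, hw⟩
    refine ⟨v + w, ?_⟩
    have : (v : R) * b = b * v := Int.cast_comm v b
    rw [← mul_assoc, hv, mul_assoc, add_mul, hw, this, ← mul_add, mul_assoc]
    push_cast
    congr 2
    abel

/-- The operator `r ↦ (t - w) r - r t`. -/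
def adShift (t : R) (w : ℤ) : AddMonoid.End R :=
  (AddMonoidHom.mulLeft t - AddMonoidHom.mulRight t - AddMonoidHom.mulLeft (w : R) : R →+ R)

theorem adShift_apply (t : R) (w : ℤ) (r : R) : adShift t w r = t * r - r * t - w * r := rfl

theorem adShift_commute (t : R) (v w : ℤ) : Commute (adShift t v) (adShift t w) := by
  apply AddMonoidHom.ext
  intro r
  change adShift t v (adShift t w r) = adShift t w (adShift t v r)
  have h1 : (v : R) * t = t * v := Int.cast_comm v t
  have h2 : (w : R) * t = t * w := Int.cast_comm w t
  have h3 : (w : R) * v = v * w := Int.cast_comm w (v : R)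
  simp only [adShift_apply, mul_sub, sub_mul, ← mul_assoc, h1, h2, h3]
  abel

/-- If `R` is spanned by eigenvectors of `ad t`, then a product of shifts of `t` moves `r`
to the left ideal generated by `t`, and kills `r` if `r t = 0`. -/
theorem exists_shift_prod_mul (t r : R) (hr : r ∈ (adEigen t).subsemiringClosure) :
    ∃ ws : List ℤ, ∃ r' : R, (r * t = 0 → r' * t = 0) ∧
      (ws.map fun w : ℤ => t + (w : R)).prod * r = r' * t := by
  -- An eigenvector is killed by one factor. For a sum, the two lists are concatenated; as the
  -- factors commute, either block can be made to act first.
  have main : ∃ ws : List ℤ, (ws.map (adShift t)).prod r = 0 := by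
    rw [Submonoid.subsemiringClosure_mem] at hr
    induction hr using AddSubmonoid.closure_induction with
    | mem v hv =>
      obtain ⟨w, hw⟩ := hv
      refine ⟨[w], ?_⟩
      simp only [List.map_cons, List.map_nil, List.prod_cons, List.prod_nil, mul_one,
        adShift_apply, hw, mul_add, Int.cast_comm]
      abel
    | zero => exact ⟨[], map_zero _⟩
    | add a b _ _ ha hb =>
      obtain ⟨v, hv⟩ := ha
      obtain ⟨w, hw⟩ := hb
      have hc : Commute (v.map (adShift t)).prod (w.map (adShift t)).prod := by
        apply Commute.list_prod_left
        intro x hx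
        apply Commute.list_prod_right
        intro y hy
        obtain ⟨i, -, rfl⟩ := List.mem_map.1 hx
        obtain ⟨j, -, rfl⟩ := List.mem_map.1 hy
        exact adShift_commute t i j
      refine ⟨v ++ w, ?_⟩
      rw [List.map_append, List.prod_append, map_add]
      nth_rewrite 1 [hc.eq]
      rw [AddMonoid.End.coe_mul, AddMonoid.End.coe_mul, Function.comp_apply, Function.comp_apply, hv, hw, map_zero, map_zero, add_zero]
  obtain ⟨ws, hws⟩ := main
  -- Modulo the left ideal `R t`, the operator `adShift t w` is left multiplication by `t - w`.
  -- Iterating yields the product of the `t - w`, whence the negated list; the remainder `r' t` is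
  -- tracked so that it vanishes when `r t = 0`.
  have key : ∀ ws : List ℤ, ∃ r' : R, (r * t = 0 → r' * t = 0) ∧
      (ws.map (adShift t)).prod r =
        ((ws.map Neg.neg).map fun w : ℤ => t + (w : R)).prod * r - r' * t := by
    intro ws
    induction ws with
    | nil => exact ⟨0, fun _ => zero_mul t, by simp⟩
    | cons w ws ih =>
      obtain ⟨r', h0, h⟩ := ih
      simp only [List.map_cons, List.prod_cons]
      generalize ((ws.map Neg.neg).map fun w : ℤ => t + (w : R)).prod = q at h ⊢
      refine ⟨(t - w) * r' + q * r - r' * t, fun hr => ?_, ?_⟩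
      · rw [sub_mul, add_mul, mul_assoc, h0 hr, mul_assoc q, hr]
        simp
      · rw [AddMonoid.End.coe_mul, Function.comp_apply, h, adShift_apply]
        push_cast
        noncomm_ring
  obtain ⟨r', h0, h⟩ := key ws
  exact ⟨ws.map Neg.neg, r', h0, by rwa [hws, eq_comm, sub_eq_zero] at h⟩

end Diagonalizable

/-! ### The coefficient ring `Ū(n)` -/

section Coeff

variable {K : Type*} [Field K] {n : ℕ}

theorem denominators_le_nonZeroDivisors : denominators K n ≤ nonZeroDivisors (U K n) := by
  refine (Submonoid.closure_le).2 ?_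
  rintro _ ⟨i, j, k, hij, rfl⟩
  rw [SetLike.mem_coe, mem_nonZeroDivisors_iff_ne_zero]
  intro h0
  -- At the point with `i`-th coordinate `1 - k` and all others zero, the denominator takes the
  -- value `1`.
  have h1 := congrArg (MvPolynomial.eval (Pi.single i (1 - (k : K)))) h0
  simp [hij.symm] at h1

instance : IsDomain (Ubar K n) :=
  IsLocalization.isDomain_of_le_nonZeroDivisors (M := denominators K n) (Ubar K n) denominators_le_nonZeroDivisors

instance : IsNoetherianRing (Ubar K n) :=
  IsLocalization.isNoetherianRing (denominators K n) _ inferInstance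

theorem algebraMap_U_apply (k : K) :
    algebraMap K (Ubar K n) k = algebraMap (U K n) (Ubar K n) (MvPolynomial.C k) :=
  (IsScalarTower.algebraMap_apply K (U K n) (Ubar K n) k)

/-- The unit hypothesis matters: `Ring.inverse` is zero on non-units, and a homomorphism may turn a
non-unit into a unit. -/
theorem map_ringInverse_of_isUnit {A C : Type*} [Ring A] [Ring C] (f : A →+* C) {u : A}
    (hu : IsUnit u) : f (Ring.inverse u) = Ring.inverse (f u) := by
  obtain ⟨u, rfl⟩ := hu
  rw [Ring.inverse_unit]
  exact (Ring.inverse_unit (Units.map (f : A →* C) u)).symm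

theorem isUnit_hd {i j : Fin n} (hij : i ≠ j) : IsUnit (hd K i j) := by
  simpa using isUnit_hd_add K hij 0

theorem hd_ne_zero {i j : Fin n} (hij : i ≠ j) : hd K i j ≠ 0 := (isUnit_hd hij).ne_zero

theorem isUnit_hd_sub_one {i j : Fin n} (hij : i ≠ j) : IsUnit (hd K i j - 1) := by
  simpa [sub_eq_add_neg] using isUnit_hd_add K hij (-1)

theorem isUnit_hd_sub_two {i j : Fin n} (hij : i ≠ j) : IsUnit (hd K i j - 2) := by
  simpa [sub_eq_add_neg] using isUnit_hd_add K hij (-2)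

theorem isUnit_hd_add_one {i j : Fin n} (hij : i ≠ j) : IsUnit (hd K i j + 1) := by
  simpa using isUnit_hd_add K hij 1

@[simp] theorem hd_self (i : Fin n) : hd K i i = 0 := sub_self _

theorem isUnit_one_sub_hd (i j : Fin n) : IsUnit (1 - hd K i j) := by
  by_cases hij : i = j
  · subst hij; simp
  · rw [← neg_sub]; exact (isUnit_hd_sub_one hij).neg

theorem isUnit_psi' (i : Fin n) : IsUnit (psi' K i) := by
  unfold psi'
  exact Finset.prod_induction _ IsUnit (fun _ _ => IsUnit.mul) isUnit_one
    fun k hk => isUnit_hd (Finset.mem_filter.mp hk).2.ne'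

/-- An algebra homomorphism out of `U(n)` making the `h̃_{ij} + k` invertible inverts all
denominators. -/
theorem isUnit_map_denominators {A : Type*} [Ring A] (f : U K n →+* A)
    (hf : ∀ (i j : Fin n) (k : ℤ), i ≠ j →
      IsUnit (f (MvPolynomial.X i) - f (MvPolynomial.X j) + (k : A)))
    {p : U K n} (hp : p ∈ denominators K n) : IsUnit (f p) := by
  induction hp using Submonoid.closure_induction with
  | mem p hp =>
    obtain ⟨i, j, k, hij, rfl⟩ := hp
    simpa using hf i j k hij
  | one => simp
  | mul a b _ _ ha hb => rw [map_mul]; exact ha.mul hb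

/-- The automorphism `h̃_i ↦ h̃_i + w_i` of `Ū(n)`. -/
noncomputable def shift (w : Fin n → ℤ) : Ubar K n →ₐ[K] Ubar K n :=
  IsLocalization.liftAlgHom (M := denominators K n)
    (f := MvPolynomial.aeval fun i => h K i + (w i : Ubar K n)) fun y =>
      isUnit_map_denominators (MvPolynomial.aeval fun i => h K i + (w i : Ubar K n)).toRingHom (by
        intro i j k hij
        have := isUnit_hd_add K hij (w i - w j + k)
        have e : (hd K i j + ((w i - w j + k : ℤ) : Ubar K n)) =
            h K i + (w i : Ubar K n) - (h K j + (w j : Ubar K n)) + k := by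
          simp only [hd]; push_cast; ring
        rw [e] at this
        simpa using this) y.2

@[simp] theorem shift_h (w : Fin n → ℤ) (i : Fin n) : shift w (h K i) = h K i + w i := by
  simp [shift, h]

theorem shift_hd (w : Fin n → ℤ) (i j : Fin n) :
    shift w (hd K i j) = hd K i j + w i - w j := by
  simp only [hd, map_sub, shift_h]; ring

theorem ubar_algHom_ext {A : Type*} [Semiring A] [Algebra K A] {f g : Ubar K n →ₐ[K] A}
    (hfg : ∀ i, f (h K i) = g (h K i)) : f = g := by
  refine IsLocalization.algHom_ext (denominators K n) ?_
  exact MvPolynomial.algHom_ext fun i => hfg i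

theorem shift_shift (v w : Fin n → ℤ) (u : Ubar K n) : shift v (shift w u) = shift (v + w) u := by
  have : (shift v).comp (shift w) = shift (K := K) (v + w) := by
    refine ubar_algHom_ext fun i => ?_
    simp [add_assoc]
  exact congrArg (fun f => f u) this

@[simp] theorem shift_zero (u : Ubar K n) : shift 0 u = u := by
  have : shift 0 = AlgHom.id K (Ubar K n) := ubar_algHom_ext fun i => by simp
  exact congrArg (fun f => f u) this

theorem shift_inverse (w : Fin n → ℤ) {u : Ubar K n} (hu : IsUnit u) :
    shift w (Ring.inverse u) = Ring.inverse (shift w u) :=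
  map_ringInverse_of_isUnit (shift w).toRingHom hu

/-! ### Elements of a given weight -/

section Weight

variable {A : Type*} [Ring A] [Algebra K A] (ι : Ubar K n →ₐ[K] A)

/-- `a` has weight `w` if `u a = a u(h̃ + w)` for all `u ∈ Ū(n)`. -/
def HasWeight (w : Fin n → ℤ) (a : A) : Prop := ∀ u, ι u * a = a * ι (shift w u)

variable {ι}

theorem HasWeight.mul {v w : Fin n → ℤ} {a b : A} (ha : HasWeight ι v a) (hb : HasWeight ι w b) :
    HasWeight ι (v + w) (a * b) := fun u => by
  rw [← mul_assoc, ha, mul_assoc, hb, shift_shift, mul_assoc, add_comm w v]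

theorem HasWeight.coeff_mul {w : Fin n → ℤ} {a : A} (ha : HasWeight ι w a) (u : Ubar K n) :
    HasWeight ι w (ι u * a) := fun v => by
  rw [← mul_assoc, ← map_mul, mul_comm v, map_mul, mul_assoc, ha, mul_assoc]

theorem HasWeight.mul_coeff {w : Fin n → ℤ} {a : A} (ha : HasWeight ι w a) (u : Ubar K n) :
    a * ι u = ι (shift (-w) u) * a := by
  rw [ha, shift_shift, add_neg_cancel, shift_zero]

theorem HasWeight.commute {a : A} (ha : HasWeight ι 0 a) (u : Ubar K n) : Commute (ι u) a := by
  have := ha u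
  rwa [shift_zero] at this

theorem HasWeight.of_isUnit {w : Fin n → ℤ} {a b : A} (ha : HasWeight ι w a) (hab : a * b = 1)
    (hba : b * a = 1) : HasWeight ι (-w) b := fun u => by
  have h1 := ha.mul_coeff u
  calc ι u * b = b * (a * ι u) * b := by rw [← mul_assoc, hba, one_mul]
    _ = b * ι (shift (-w) u) := by rw [h1, mul_assoc, mul_assoc, hab, mul_one]

/-- Relations with the `h̃_i` alone extend to polynomials by induction, and to fractions because
denominators become units and can be cancelled. -/
theorem hasWeight_of_h {w : Fin n → ℤ} {a : A}
    (ha : ∀ i, ι (h K i) * a = a * ι (h K i + w i)) : HasWeight ι w a := by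
  have hU : ∀ p : U K n, ι (algebraMap _ _ p) * a = a * ι (shift w (algebraMap _ _ p)) := by
    intro p
    induction p using MvPolynomial.induction_on with
    | C k =>
      rw [← algebraMap_U_apply, AlgHom.commutes, AlgHom.commutes, AlgHom.commutes,
        Algebra.commutes]
    | add p q hp hq => simp only [map_add, add_mul, mul_add, hp, hq]
    | mul_X p i hp =>
      have := ha i
      rw [← shift_h] at this
      simp only [map_mul]
      change _ * ι (h K i) * a = a * (_ * ι (shift w (h K i)))
      rw [mul_assoc, this, ← mul_assoc, hp, mul_assoc]
  intro u
  obtain ⟨p, s, rfl⟩ := IsLocalization.exists_mk'_eq (denominators K n) u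
  set v := IsLocalization.mk' (Ubar K n) p s
  have hs : IsUnit (algebraMap (U K n) (Ubar K n) s) := IsLocalization.map_units _ s
  have hv : algebraMap (U K n) (Ubar K n) s * v = algebraMap _ _ p := by
    rw [mul_comm]; exact IsLocalization.mk'_spec _ p s
  have h1 : IsUnit (ι (algebraMap (U K n) (Ubar K n) s)) := hs.map ι
  refine h1.mul_left_cancel ?_
  rw [← mul_assoc, ← map_mul, hv, hU, ← hv, ← mul_assoc, hU, mul_assoc, map_mul, map_mul]

theorem hasWeight_coeff (u : Ubar K n) : HasWeight ι 0 (ι u) := fun v => by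
  rw [shift_zero, ← map_mul, mul_comm, map_mul]

end Weight

end Coeff

/-! ### Generating polynomials of the elementary symmetric polynomials and Lagrange interpolation -/

section Lagrange

open Polynomial

variable {K : Type*} [Field K] {n : ℕ}

variable (K n) in
/-- `∏_i (z + h̃_i)`. -/
noncomputable def genPoly : (Ubar K n)[X] := ∏ i, (X + C (h K i))

/-- `∏_{i ≠ k} (z + h̃_i)`. -/
noncomputable def genPolyErase (k : Fin n) : (Ubar K n)[X] :=
  ∏ i ∈ Finset.univ.erase k, (X + C (h K i))

theorem genPoly_eq (k : Fin n) : genPoly K n = (X + C (h K k)) * genPolyErase k :=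
  (Finset.mul_prod_erase _ _ (Finset.mem_univ k)).symm

theorem genPolyErase_eq {j k : Fin n} (hjk : k ≠ j) :
    genPolyErase (K := K) k =
      (X + C (h K j)) * ∏ i ∈ (Finset.univ.erase k).erase j, (X + C (h K i)) :=
  (Finset.mul_prod_erase _ _ (Finset.mem_erase.2 ⟨hjk.symm, Finset.mem_univ j⟩)).symm

theorem map_shift_prod {j : Fin n} (c : ℤ) (s : Finset (Fin n)) (hj : j ∉ s) :
    (∏ i ∈ s, (X + C (h K i))).map (shift (Pi.single j c)).toRingHom =
      ∏ i ∈ s, (X + C (h K i)) := by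
  rw [Polynomial.map_prod]
  refine Finset.prod_congr rfl fun i hi => ?_
  have : i ≠ j := fun e => hj (e ▸ hi)
  simp [this]

theorem map_shift_genPolyErase_self (j : Fin n) (c : ℤ) :
    (genPolyErase j).map (shift (K := K) (Pi.single j c)).toRingHom = genPolyErase j :=
  map_shift_prod c _ (Finset.notMem_erase j _)

/-- Only the factor `z + h̃_j` moves, and it drops by one. -/
theorem map_shift_genPoly (j : Fin n) :
    (genPoly K n).map (shift (K := K) (Pi.single j (-1))).toRingHom =
      genPoly K n - genPolyErase j := by
  rw [genPoly_eq j, Polynomial.map_mul, map_shift_genPolyErase_self]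
  simp
  ring

/-- After removing the common factor `∏_{i ≠ j, k} (z + h̃_i)`, this is `h̃_{jk} (z + h̃_j - 1) - (z
+ h̃_k) = (h̃_{jk} - 1)(z + h̃_j)`. It is the identity behind the commutation of `c_k` with `x^j`.
-/
theorem map_shift_genPolyErase {j k : Fin n} (hjk : k ≠ j) :
    C (hd K j k) * (genPolyErase k).map (shift (K := K) (Pi.single j (-1))).toRingHom
      - genPolyErase j = C (hd K j k - 1) * genPolyErase k := by
  rw [genPolyErase_eq hjk, genPolyErase_eq hjk.symm, Polynomial.map_mul,
    map_shift_prod _ _ (Finset.notMem_erase j _), Finset.erase_right_comm]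
  simp [hd]
  ring

theorem natDegree_genPolyErase (k : Fin n) : (genPolyErase (K := K) k).natDegree = n - 1 := by
  unfold genPolyErase
  rw [natDegree_prod_of_monic _ _ fun _ _ => monic_X_add_C _]
  simp

theorem degree_genPolyErase_lt (k : Fin n) : (genPolyErase (K := K) k).degree < n := by
  have : 0 < n := k.pos
  refine lt_of_le_of_lt degree_le_natDegree ?_
  rw [natDegree_genPolyErase]
  exact_mod_cast Nat.sub_lt this one_pos

theorem monic_genPoly : (genPoly K n).Monic := monic_prod_of_monic _ _ fun _ _ => monic_X_add_C _

theorem natDegree_genPoly : (genPoly K n).natDegree = n := by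
  unfold genPoly
  rw [natDegree_prod_of_monic _ _ fun _ _ => monic_X_add_C _]
  simp

theorem coeff_genPoly_self : (genPoly K n).coeff n = 1 := by
  have := (monic_genPoly (K := K) (n := n)).coeff_natDegree
  rwa [natDegree_genPoly] at this

theorem coeff_prod_X_add_C {m : ℕ} (hm : m ≤ n) :
    (∏ i, (X + C (MvPolynomial.X i : U K n))).coeff (n - m) =
      MvPolynomial.esymm (Fin n) K m := by
  have := Multiset.prod_X_add_C_coeff (Finset.univ.val.map (MvPolynomial.X : Fin n → U K n))
    (k := n - m) (by simp)
  rw [MvPolynomial.esymm_eq_multiset_esymm]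
  simp only [Multiset.map_map, Multiset.card_map, Finset.card_val, Finset.card_univ,
    Fintype.card_fin, Nat.sub_sub_self hm] at this
  exact this

theorem algebraMap_esymm {m : ℕ} (hm : m ≤ n) :
    algebraMap (U K n) (Ubar K n) (MvPolynomial.esymm (Fin n) K m) =
      (genPoly K n).coeff (n - m) := by
  have e : genPoly K n = (∏ i : Fin n, (X + C (MvPolynomial.X i : U K n))).map
      (algebraMap (U K n) (Ubar K n)) := by
    simp [genPoly, Polynomial.map_prod, h]
  rw [e, coeff_map, coeff_prod_X_add_C hm]

theorem pderiv_coeff_prod (k : Fin n) (s : Finset (Fin n)) (hk : k ∉ s) (r : ℕ) :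
    MvPolynomial.pderiv k ((∏ i ∈ s, (X + C (MvPolynomial.X i : U K n))).coeff r) = 0 := by
  induction s using Finset.induction_on generalizing r with
  | empty =>
    simp only [Finset.prod_empty, coeff_one]
    split_ifs <;> simp
  | insert i s hi ih =>
    rw [Finset.mem_insert, not_or] at hk
    have h0 : MvPolynomial.pderiv k (MvPolynomial.X i : U K n) = 0 :=
      MvPolynomial.pderiv_X_of_ne (Ne.symm hk.1)
    rw [Finset.prod_insert hi, add_mul, coeff_add, coeff_C_mul, map_add, Derivation.leibniz,
      ih hk.2, h0]
    cases r with
    | zero => simp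
    | succ r => rw [coeff_X_mul, ih hk.2]; simp

/-- Differentiate `(z + h̃_k) F_k` coefficientwise: `F_k` does not involve `h̃_k`. The bound on `m`
keeps the subtraction `n - m` honest. -/
theorem algebraMap_pderiv_esymm (k : Fin n) {m : ℕ} (hm : m ≤ n) :
    algebraMap (U K n) (Ubar K n) (MvPolynomial.pderiv k (MvPolynomial.esymm (Fin n) K m)) =
      (genPolyErase (K := K) k).coeff (n - m) := by
  have e : genPolyErase (K := K) k =
      (∏ i ∈ Finset.univ.erase k, (X + C (MvPolynomial.X i : U K n))).map
      (algebraMap (U K n) (Ubar K n)) := by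
    simp [genPolyErase, Polynomial.map_prod, h]
  rw [e, coeff_map]
  congr 1
  rw [← coeff_prod_X_add_C hm, ← Finset.mul_prod_erase _ _ (Finset.mem_univ k), add_mul,
    coeff_add, coeff_C_mul, map_add, Derivation.leibniz,
    pderiv_coeff_prod k _ (Finset.notMem_erase k _), MvPolynomial.pderiv_X_self]
  generalize n - m = r
  cases r with
  | zero => simp
  | succ r =>
    rw [coeff_X_mul, pderiv_coeff_prod k _ (Finset.notMem_erase k _)]; simp

/-- `∏_{i ≠ k} h̃_{ik}`. -/
noncomputable def nodeDiff (k : Fin n) : Ubar K n := ∏ i ∈ Finset.univ.erase k, hd K i k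

theorem isUnit_nodeDiff (k : Fin n) : IsUnit (nodeDiff (K := K) k) :=
  Finset.prod_induction _ IsUnit (fun _ _ => IsUnit.mul) isUnit_one
    fun _ hi => isUnit_hd (Finset.ne_of_mem_erase hi)

theorem eval_genPolyErase (j k : Fin n) :
    (genPolyErase (K := K) j).eval (-h K k) = if j = k then nodeDiff k else 0 := by
  unfold genPolyErase
  rw [eval_prod]
  split_ifs with hjk
  · subst hjk
    refine Finset.prod_congr rfl fun i _ => ?_
    simp [hd]; ring
  · exact Finset.prod_eq_zero (Finset.mem_erase.2 ⟨Ne.symm hjk, Finset.mem_univ k⟩) (by simp)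

theorem eval_genPoly (k : Fin n) : (genPoly K n).eval (-h K k) = 0 := by
  rw [genPoly_eq k]; simp

/-- Both sides have degree below `n` and agree at the `n` distinct points `-h̃_k` of a domain. The
node differences are units, so no passage to the fraction field is needed. -/
theorem lagrange (p : (Ubar K n)[X]) (hp : p.degree < n) :
    ∑ k, C (p.eval (-h K k) * Ring.inverse (nodeDiff k)) * genPolyErase k = p := by
  refine Polynomial.eq_of_degree_sub_lt_of_eval_index_eq (s := Finset.univ)
    (v := fun k => -h K k) ?_ ?_ ?_
  · intro i _ j _ hij
    by_contra hne
    exact hd_ne_zero hne (sub_eq_zero.2 (neg_injective hij))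
  · rw [Finset.card_univ, Fintype.card_fin]
    refine lt_of_le_of_lt (degree_sub_le _ _) (max_lt ?_ hp)
    refine lt_of_le_of_lt (degree_sum_le _ _) ?_
    rw [Finset.sup_lt_iff (by exact WithBot.bot_lt_coe n)]
    intro k _
    rw [← smul_eq_C_mul]
    exact lt_of_le_of_lt (degree_smul_le _ _) (degree_genPolyErase_lt k)
  · intro k _
    rw [eval_finsetSum, Finset.sum_eq_single k]
    · rw [eval_mul, eval_C, eval_genPolyErase, if_pos rfl, mul_assoc,
        Ring.inverse_mul_cancel _ (isUnit_nodeDiff k), mul_one]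
    · intro j _ hjk
      rw [eval_mul, eval_genPolyErase, if_neg hjk, mul_zero]
    · simp

/-- `(-h̃_k)^r / ∏_{i ≠ k} h̃_{ik}`. -/
noncomputable def lagCoeff (k : Fin n) (r : ℕ) : Ubar K n :=
  (-h K k) ^ r * Ring.inverse (nodeDiff k)

/-- Interpolation of `z ^ r`. At `r = n` the degree is one too large, so `z ^ n` is replaced by its
remainder `z ^ n - ∏ (z + h̃_i)`, which has the same values at the nodes. -/
theorem sum_lagCoeff_mul (r : ℕ) (hr : r ≤ n) :
    ∑ k, C (lagCoeff k r) * genPolyErase k =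
      (X ^ r - if r = n then genPoly K n else 0) := by
  split_ifs with hrn
  · subst hrn
    have hdeg : (X ^ r - genPoly K r).degree < (r : WithBot ℕ) := by
      have := degree_sub_lt_left (p := (X : (Ubar K r)[X]) ^ r) (q := genPoly K r)
        (by rw [degree_X_pow, degree_eq_natDegree monic_genPoly.ne_zero, natDegree_genPoly])
        (monic_X_pow r).ne_zero (by rw [(monic_X_pow r).leadingCoeff, monic_genPoly.leadingCoeff])
      rwa [degree_X_pow] at this
    rw [← lagrange _ hdeg]
    simp [lagCoeff, eval_genPoly]
  · have hdeg : ((X : (Ubar K n)[X]) ^ r).degree < n := by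
      rw [degree_X_pow]; exact_mod_cast lt_of_le_of_ne hr hrn
    refine Eq.trans ?_ (sub_zero (X ^ r : (Ubar K n)[X])).symm
    rw [← lagrange _ hdeg]
    simp [lagCoeff]

theorem sum_lagCoeff_mul_coeff {r : ℕ} (r' : ℕ) (hr : r ≤ n) :
    ∑ k, lagCoeff k r * (genPolyErase (K := K) k).coeff r' =
      (if r' = r then 1 else 0) - if r = n then (genPoly K n).coeff r' else 0 := by
  have := congrArg (fun p => p.coeff r') (sum_lagCoeff_mul (K := K) r hr)
  simp only [finsetSum_coeff, coeff_C_mul, coeff_sub, coeff_X_pow] at this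
  rw [this]
  split_ifs <;> simp

/-- The product of the two matrices in the other order: up to normalization, the sum evaluates `F_j`
at the node `-h̃_k`. -/
theorem sum_lagCoeff_mul_coeff_erase (j k : Fin n) :
    ∑ r ∈ Finset.range n, lagCoeff k r * (genPolyErase (K := K) j).coeff r =
      if j = k then 1 else 0 := by
  have := eval_genPolyErase (K := K) j k
  have hn : (genPolyErase (K := K) j).natDegree < n := by
    rw [natDegree_genPolyErase]; exact Nat.sub_lt j.pos one_pos
  rw [eval_eq_sum_range' hn] at this
  have e : ∀ r, lagCoeff k r * (genPolyErase (K := K) j).coeff r =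
      Ring.inverse (nodeDiff k) * ((genPolyErase (K := K) j).coeff r * (-h K k) ^ r) := by
    intro r; rw [lagCoeff]; ring
  simp only [e]
  rw [← Finset.mul_sum, this]
  split_ifs
  · rw [Ring.inverse_mul_cancel _ (isUnit_nodeDiff k)]
  · rw [mul_zero]

theorem sum_lagCoeff_mul_coeff_genPoly (k : Fin n) :
    ∑ r ∈ Finset.range n, lagCoeff k r * (genPoly K n).coeff r = - lagCoeff k n := by
  have := eval_genPoly (K := K) k
  rw [eval_eq_sum_range, natDegree_genPoly, Finset.sum_range_succ, coeff_genPoly_self] at this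
  have e : ∀ r, lagCoeff k r * (genPoly K n).coeff r =
      Ring.inverse (nodeDiff k) * ((genPoly K n).coeff r * (-h K k) ^ r) := by
    intro r; rw [lagCoeff]; ring
  simp only [e]
  rw [← Finset.mul_sum, lagCoeff]
  linear_combination Ring.inverse (nodeDiff k) * this

/-- For `k ≠ j` the only factor of the denominator affected is `h̃_{jk}`, which becomes `h̃_{jk} -
1`. -/
theorem shift_lagCoeff {j k : Fin n} (hjk : k ≠ j) (r : ℕ) :
    (hd K j k - 1) * shift (Pi.single j (-1)) (lagCoeff k r) = hd K j k * lagCoeff k r := by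
  have hmem : j ∈ Finset.univ.erase k := Finset.mem_erase.2 ⟨hjk.symm, Finset.mem_univ j⟩
  have e1 : shift (Pi.single j (-1)) (nodeDiff (K := K) k) =
      (hd K j k - 1) * ∏ i ∈ (Finset.univ.erase k).erase j, hd K i k := by
    rw [nodeDiff, map_prod, ← Finset.mul_prod_erase _ _ hmem]
    congr 1
    · simp [shift_hd, hjk, sub_eq_add_neg]
    · refine Finset.prod_congr rfl fun i hi => ?_
      simp [shift_hd, hjk, Finset.ne_of_mem_erase hi]
  have e2 : nodeDiff (K := K) k = hd K j k * ∏ i ∈ (Finset.univ.erase k).erase j, hd K i k :=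
    (Finset.mul_prod_erase _ _ hmem).symm
  have h1 := Ring.inverse_mul_cancel _ (isUnit_nodeDiff (K := K) k)
  have h2 := Ring.inverse_mul_cancel _ ((isUnit_nodeDiff (K := K) k).map (shift (Pi.single j (-1))))
  rw [lagCoeff, map_mul, map_pow, map_neg, shift_h, shift_inverse _ (isUnit_nodeDiff k),
    Pi.single_apply, if_neg hjk, Int.cast_zero, add_zero]
  refine (isUnit_nodeDiff (K := K) k).mul_left_cancel ?_
  refine ((isUnit_nodeDiff (K := K) k).map (shift (Pi.single j (-1)))).mul_left_cancel ?_
  rw [e1, e2] at *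
  generalize ∏ i ∈ (Finset.univ.erase k).erase j, hd K i k = P at *
  generalize Ring.inverse ((hd K j k - 1) * P) = a at *
  generalize Ring.inverse (hd K j k * P) = b at *
  linear_combination (-h K k) ^ r * (hd K j k - 1) * (hd K j k) * P * (h2 - h1)

/-- Evaluate the interpolation identity at `z = 1 - h̃_j` and divide by `P = ∏_i (1 - h̃_{ji})`.
There `F_k` equals `P / (1 - h̃_{jk})`, and `P` is also the shifted denominator of `lagCoeff j`. The
case `r = n` will produce the constant `-1` in the relation for `x^j ∂̄_j`. -/
theorem sum_inverse_mul_lagCoeff (j : Fin n) (r : ℕ) (hr : r ≤ n) :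
    ∑ k, Ring.inverse (1 - hd K j k) * lagCoeff k r =
      shift (Pi.single j (-1)) (lagCoeff j r) - if r = n then 1 else 0 := by
  set P : Ubar K n := ∏ i ∈ Finset.univ.erase j, (1 - hd K j i) with hP
  have hPu : IsUnit P := Finset.prod_induction _ IsUnit (fun _ _ => IsUnit.mul) isUnit_one
    fun i _ => isUnit_one_sub_hd j i
  have hP' : P = ∏ i, (1 - hd K j i) := by
    rw [← Finset.mul_prod_erase _ _ (Finset.mem_univ j), ← hP]; simp
  have e1 : shift (Pi.single j (-1)) (nodeDiff (K := K) j) = P := by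
    rw [nodeDiff, map_prod]
    refine Finset.prod_congr rfl fun i hi => ?_
    rw [shift_hd]
    simp [Finset.ne_of_mem_erase hi, hd]
    ring
  have e2 : ∀ k, (genPolyErase (K := K) k).eval (1 - h K j) =
      P * Ring.inverse (1 - hd K j k) := by
    intro k
    rw [hP', ← Finset.mul_prod_erase _ _ (Finset.mem_univ k), mul_comm, ← mul_assoc,
      Ring.inverse_mul_cancel _ (isUnit_one_sub_hd j k), one_mul, genPolyErase, eval_prod]
    refine Finset.prod_congr rfl fun i _ => ?_
    simp [hd]; ring
  have e3 : (genPoly K n).eval (1 - h K j) = P := by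
    rw [hP', genPoly, eval_prod]
    refine Finset.prod_congr rfl fun i _ => ?_
    simp [hd]; ring
  have main := congrArg (eval (1 - h K j)) (sum_lagCoeff_mul (K := K) r hr)
  rw [eval_finsetSum] at main
  simp only [eval_mul, eval_C, e2, eval_sub, eval_pow, eval_X, apply_ite (eval (1 - h K j)), e3,
    eval_zero] at main
  refine hPu.mul_left_cancel ?_
  rw [lagCoeff, map_mul, map_pow, map_neg, shift_h, shift_inverse _ (isUnit_nodeDiff j), e1,
    Pi.single_eq_same, Finset.mul_sum, mul_sub, mul_left_comm P, Ring.mul_inverse_cancel _ hPu]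
  have e4 : ∀ k, P * (Ring.inverse (1 - hd K j k) * lagCoeff k r) =
      lagCoeff k r * (P * Ring.inverse (1 - hd K j k)) := fun k => by ring
  simp only [e4]
  rw [main]
  push_cast
  split_ifs <;> ring

end Lagrange

/-! ### Relations in `Diff_h(n)` -/

section DiffRelations

variable {K : Type*} [Field K] {n : ℕ}

theorem ofU_add (u v : Ubar K n) : ofU (u + v) = ofU u + ofU v := by
  simpa [ofU] using RingQuot.mkAlgHom_rel K (DiffRel.coeff_add u v)

theorem ofU_algebraMap (a : K) :
    ofU (algebraMap K (Ubar K n) a) = algebraMap K (Diff K n) a := by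
  simpa [ofU] using RingQuot.mkAlgHom_rel K (DiffRel.coeff_algebraMap (n := n) a)

variable (K n) in
/-- The homomorphism `Ū(n) → Diff_h(n)`. -/
noncomputable def ofUHom : Ubar K n →ₐ[K] Diff K n where
  toFun := ofU
  map_one' := ofU_one
  map_mul' := ofU_mul
  map_zero' := by
    have := ofU_algebraMap (n := n) (0 : K)
    simpa using this
  map_add' := ofU_add
  commutes' := ofU_algebraMap

theorem ofUHom_apply (u : Ubar K n) : ofUHom K n u = ofU u := rfl

theorem ofU_sub (u v : Ubar K n) : ofU (u - v) = ofU u - ofU v := map_sub (ofUHom K n) u v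

theorem ofU_zero : ofU (0 : Ubar K n) = 0 := map_zero (ofUHom K n)

theorem isUnit_ofU {u : Ubar K n} (hu : IsUnit u) : IsUnit (ofU u) := hu.map (ofUHom K n)

theorem hasWeight_x (j : Fin n) : HasWeight (ofUHom K n) (Pi.single j 1) (x K j) := by
  refine hasWeight_of_h fun i => ?_
  have := RingQuot.mkAlgHom_rel K (DiffRel.weight_x (K := K) i j)
  simp only [map_mul] at this
  rw [Pi.single_apply]
  push_cast
  exact this

theorem hasWeight_d (j : Fin n) : HasWeight (ofUHom K n) (Pi.single j (-1)) (d K j) := by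
  refine hasWeight_of_h fun i => ?_
  have := RingQuot.mkAlgHom_rel K (DiffRel.weight_d (K := K) i j)
  simp only [map_mul] at this
  rw [Pi.single_apply]
  have e : h K i - (if i = j then 1 else 0) =
      h K i + (((if i = j then (-1) else 0 : ℤ)) : Ubar K n) := by
    split_ifs <;> simp [sub_eq_add_neg]
  rw [e] at this
  exact this

theorem x_mul_ofU (j : Fin n) (u : Ubar K n) :
    x K j * ofU u = ofU (shift (Pi.single j (-1)) u) * x K j := by
  have := (hasWeight_x (K := K) j).mul_coeff u
  rwa [← Pi.single_neg] at this

theorem d_mul_ofU (j : Fin n) (u : Ubar K n) :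
    d K j * ofU u = ofU (shift (Pi.single j 1) u) * d K j := by
  have := (hasWeight_d (K := K) j).mul_coeff u
  rwa [← Pi.single_neg, neg_neg] at this

theorem ofU_mul_x (j : Fin n) (u : Ubar K n) :
    ofU u * x K j = x K j * ofU (shift (Pi.single j 1) u) := hasWeight_x j u

theorem hasWeight_Gam (k : Fin n) : HasWeight (ofUHom K n) 0 (Gam K k) := by
  have := (hasWeight_d (K := K) k).mul (hasWeight_x k)
  rwa [← Pi.single_add, neg_add_cancel, Pi.single_zero] at this

theorem ofU_commute_Gam (k : Fin n) (u : Ubar K n) : Commute (ofU u) (Gam K k) :=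
  (hasWeight_Gam k).commute u

theorem x_mul_x {i j : Fin n} (hij : i < j) :
    x K i * x K j = ofU ((hd K i j + 1) * Ring.inverse (hd K i j)) * (x K j * x K i) := by
  have := RingQuot.mkAlgHom_rel K (DiffRel.x_x (K := K) i j hij)
  simp only [map_mul] at this
  exact this

theorem d_mul_d {i j : Fin n} (hij : i < j) :
    d K i * d K j = ofU ((hd K i j - 1) * Ring.inverse (hd K i j)) * (d K j * d K i) := by
  have := RingQuot.mkAlgHom_rel K (DiffRel.d_d (K := K) i j hij)
  simp only [map_mul] at this
  exact this

theorem x_mul_d_of_lt {i j : Fin n} (hij : i < j) : x K i * d K j = d K j * x K i := by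
  have := RingQuot.mkAlgHom_rel K (DiffRel.x_d_lt (K := K) i j hij)
  simp only [map_mul] at this
  exact this

theorem x_mul_d_of_gt {i j : Fin n} (hij : j < i) :
    x K i * d K j = ofU (hd K i j * (hd K i j - 2) * Ring.inverse ((hd K i j - 1) ^ 2)) *
      (d K j * x K i) := by
  have := RingQuot.mkAlgHom_rel K (DiffRel.x_d_gt (K := K) i j hij)
  simp only [map_mul] at this
  exact this

theorem x_mul_d_self (i : Fin n) :
    x K i * d K i = ∑ j, ofU (Ring.inverse (1 - hd K i j)) * Gam K j - 1 := by
  have := RingQuot.mkAlgHom_rel K (DiffRel.x_d_eq (K := K) i)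
  simp only [map_mul, map_sub, map_sum, map_one] at this
  exact this

theorem eq_ofU_inverse_mul {u : Ubar K n} (hu : IsUnit u) {a b : Diff K n} (hab : a = ofU u * b) :
    b = ofU (Ring.inverse u) * a := by
  rw [hab, ← mul_assoc, ← ofU_mul, Ring.inverse_mul_cancel _ hu, ofU_one, one_mul]

theorem hd_neg (i j : Fin n) : hd K j i = -hd K i j := by simp [hd]

theorem x_mul_x_of_gt {j k : Fin n} (hkj : k < j) :
    x K j * x K k = ofU (hd K j k * Ring.inverse (hd K j k - 1)) * (x K k * x K j) := by
  have h1 := x_mul_x (K := K) hkj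
  have hz1 := isUnit_hd_sub_one (K := K) hkj.ne'
  have e2 := Ring.inverse_mul_cancel _ hz1
  have hz' := isUnit_hd (K := K) hkj.ne
  have e3 := Ring.inverse_mul_cancel _ hz'
  rw [hd_neg j k] at h1 e3
  rw [h1, ← mul_assoc, ← ofU_mul]
  have : hd K j k * Ring.inverse (hd K j k - 1) * ((-hd K j k + 1) * Ring.inverse (-hd K j k)) =
      1 := by
    linear_combination e2 * (-hd K j k) * Ring.inverse (-hd K j k) + e3
  rw [this, ofU_one, one_mul]

/-- The relations distinguish `k < j` from `k > j`, but moving `x^j` past both factors of `Γ_k`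
gives the same coefficient `h̃_{jk} / (h̃_{jk} - 1)` in both cases. -/
theorem x_mul_Gam_of_ne {j k : Fin n} (hkj : k ≠ j) :
    x K j * Gam K k = ofU (hd K j k * Ring.inverse (hd K j k - 1)) * Gam K k * x K j := by
  have hz := isUnit_hd (K := K) hkj.symm
  have hz1 := isUnit_hd_sub_one (K := K) hkj.symm
  have hz2 := isUnit_hd_sub_two (K := K) hkj.symm
  have s1 : shift (Pi.single k 1) (hd K j k) = hd K j k - 1 := by
    simp [shift_hd, hkj.symm]
  rcases lt_or_gt_of_ne hkj with hlt | hlt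
  · rw [Gam, ← mul_assoc, x_mul_d_of_gt hlt, mul_assoc (ofU _), mul_assoc (d K k), x_mul_x_of_gt hlt,
      ← mul_assoc (d K k), d_mul_ofU, map_mul, shift_inverse _ hz1, map_sub, s1, map_one]
    simp only [mul_assoc]
    simp only [← mul_assoc (ofU _) (ofU _), ← ofU_mul]
    congr 2
    have e1 := Ring.inverse_mul_cancel _ hz1
    have e2 := Ring.inverse_mul_cancel _ hz2
    have e3 := Ring.inverse_mul_cancel _ (hz1.pow 2)
    have e4 : hd K j k - 1 - 1 = hd K j k - 2 := by ring
    rw [e4]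
    refine (hz1.pow 2).mul_left_cancel ?_
    linear_combination hd K j k * (hd K j k - 1) ^ 1 * e2 + (hd K j k *
      (hd K j k - 2) * (hd K j k - 1) * Ring.inverse (hd K j k - 2)) * e3
      - hd K j k * (hd K j k - 1) * e1
  · rw [Gam, ← mul_assoc, x_mul_d_of_lt hlt, mul_assoc, x_mul_x hlt, ← mul_assoc, d_mul_ofU,
      map_mul, shift_inverse _ hz, map_add, s1, map_one, sub_add_cancel]
    simp only [mul_assoc]

theorem x_mul_Gam_self (j : Fin n) :
    x K j * Gam K j = (∑ l, ofU (Ring.inverse (1 - hd K j l)) * Gam K l - 1) * x K j := by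
  rw [Gam, ← mul_assoc, x_mul_d_self]

/-- A uniform formula: for `k = j` the first coefficient vanishes because `h̃_{jj} = 0`. -/
theorem x_mul_Gam (j k : Fin n) :
    x K j * Gam K k = (ofU (hd K j k * Ring.inverse (hd K j k - 1)) * Gam K k +
      if k = j then ∑ l, ofU (Ring.inverse (1 - hd K j l)) * Gam K l - 1 else 0) * x K j := by
  split_ifs with hkj
  · subst hkj
    rw [x_mul_Gam_self, hd_self, zero_mul, ofU_zero, zero_mul, zero_add]
  · rw [x_mul_Gam_of_ne hkj, add_zero]

/-- For `i < j`, with `z = h̃_{ij}`, both orders reduce to `((z² - 1) / z²) ∂̄_j ∂̄_i x^j x^i`. -/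
theorem Gam_commute_Gam (i j : Fin n) : Commute (Gam K i) (Gam K j) := by
  have key : ∀ i j : Fin n, i < j → Gam K i * Gam K j = Gam K j * Gam K i := by
    intro i j hij
    have hz := isUnit_hd (K := K) hij.ne
    have e1 := Ring.inverse_mul_cancel _ hz
    have hw1 : IsUnit (hd K j i - 1) := isUnit_hd_sub_one hij.ne'
    have s1 : shift (Pi.single j 1) (hd K j i) = hd K j i + 1 := by
      simp [shift_hd, hij.ne]
    have s2 : shift (Pi.single j 1 + Pi.single i 1) (hd K i j) = hd K i j := by
      simp [shift_hd, hij.ne, hij.ne']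
    have l1 : Gam K i * Gam K j = d K i * d K j * (x K i * x K j) := by
      simp only [Gam, mul_assoc]
      rw [← mul_assoc (x K i), x_mul_d_of_lt hij, mul_assoc]
    have l2 : Gam K j * Gam K i = d K j * ofU (hd K j i * (hd K j i - 2) *
        Ring.inverse ((hd K j i - 1) ^ 2)) * d K i * (x K j * x K i) := by
      simp only [Gam, mul_assoc]
      rw [← mul_assoc (x K j), x_mul_d_of_gt hij]
      simp only [mul_assoc]
    have w := ((hasWeight_d (K := K) j).mul (hasWeight_d i)).mul_coeff
      ((hd K i j + 1) * Ring.inverse (hd K i j))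
    rw [neg_add, ← Pi.single_neg, ← Pi.single_neg, neg_neg,
      map_mul (shift _),
      shift_inverse _ hz, map_add, s2, map_one, ofUHom_apply] at w
    rw [l1, l2, d_mul_d hij, x_mul_x hij, mul_assoc (ofU _), ← mul_assoc (d K j * d K i), w,
      d_mul_ofU, map_mul, map_mul, shift_inverse _ (hw1.pow 2), map_pow, map_sub, map_sub, s1,
      map_one, map_ofNat]
    simp only [mul_assoc]
    simp only [← mul_assoc (ofU _) (ofU _), ← ofU_mul]
    congr 2
    have e5 : hd K j i + 1 - 1 = -hd K i j := by rw [hd_neg i j]; ring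
    have e6 := Ring.inverse_mul_cancel _ (hz.neg.pow 2)
    rw [e5]
    rw [hd_neg i j]
    refine (hz.pow 2).mul_left_cancel ?_
    generalize Ring.inverse ((-hd K i j) ^ 2) = b at *
    generalize Ring.inverse (hd K i j) = a at *
    generalize hd K i j = z at *
    linear_combination (z - 1) * (z + 1) * (a * z + 1) * e1 - (z - 1) * (z + 1) * e6
  rcases lt_trichotomy i j with hij | rfl | hij
  · exact key i j hij
  · exact Commute.refl _
  · exact (key j i hij).symm

/-! ### The central elements -/

theorem c_eq {m : ℕ} (hm : m ≤ n) :
    c K n m = ∑ k, ofU ((genPolyErase (K := K) k).coeff (n - m)) * Gam K k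
      - ofU ((genPoly K n).coeff (n - m)) := by
  rw [c, algebraMap_esymm hm]
  congr 1
  exact Finset.sum_congr rfl fun k _ => by rw [algebraMap_pderiv_esymm k hm]

theorem c_commute_ofU (m : ℕ) (u : Ubar K n) : Commute (ofU u) (c K n m) := by
  have hcomm : ∀ v : Ubar K n, Commute (ofU u) (ofU v) := fun v => by
    rw [Commute, SemiconjBy, ← ofU_mul, ← ofU_mul, mul_comm]
  exact Commute.sub_right (Commute.sum_right _ _ _ fun k _ =>
    (hcomm _).mul_right (ofU_commute_Gam k u)) (hcomm _)

theorem c_commute_Gam (m : ℕ) (k : Fin n) : Commute (Gam K k) (c K n m) :=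
  Commute.sub_right (Commute.sum_right _ _ _ fun l _ =>
    (ofU_commute_Gam k _).symm.mul_right (Gam_commute_Gam k l)) (ofU_commute_Gam k _).symm

theorem c_commute_c (m m' : ℕ) : Commute (c K n m) (c K n m') :=
  Commute.sub_left (Commute.sum_left _ _ _ fun k _ =>
    (c_commute_ofU m' _).mul_left (c_commute_Gam m' k)) (c_commute_ofU m' _)

/-- Move `x^j` to the right and compare coefficients of each `Γ_k`. The defect is governed by
`map_shift_genPolyErase`; the constant `-1` in the relation for `x^j Γ_j` is matched by
`map_shift_genPoly`. -/
theorem c_commute_x {m : ℕ} (hm : m ≤ n) (j : Fin n) : Commute (x K j) (c K n m) := by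
  obtain ⟨r, hr⟩ : ∃ r, r = n - m := ⟨_, rfl⟩
  have hF := congrArg (fun p => p.coeff r) (map_shift_genPoly (K := K) j)
  have hFj := congrArg (fun p => p.coeff r) (map_shift_genPolyErase_self (K := K) j (-1))
  have hFk : ∀ k, k ≠ j → _ := fun k hk =>
    congrArg (fun p => p.coeff r) (map_shift_genPolyErase (K := K) hk)
  simp only [Polynomial.coeff_map, Polynomial.coeff_sub, Polynomial.coeff_C_mul] at hF hFj hFk
  change shift _ _ = _ at hF hFj
  change ∀ k, k ≠ j → hd K j k * shift _ _ - _ = _ at hFk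
  -- The coefficient of `Γ_k` collects the direct term from `x^j Γ_k` and one contribution from the
  -- expansion of `x^j Γ_j`. For `k = j` only the latter survives.
  have coef : ∀ k, shift (Pi.single j (-1)) ((genPolyErase (K := K) k).coeff r) *
      (hd K j k * Ring.inverse (hd K j k - 1)) +
      (genPolyErase (K := K) j).coeff r * Ring.inverse (1 - hd K j k) =
      (genPolyErase (K := K) k).coeff r := by
    intro k
    by_cases hk : k = j
    · subst hk; simp
    · have h1 := hFk k hk
      have u1 := isUnit_hd_sub_one (K := K) (Ne.symm hk)
      have e1 := Ring.inverse_mul_cancel _ u1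
      have e2 := Ring.inverse_mul_cancel _ (isUnit_one_sub_hd (K := K) j k)
      refine u1.mul_left_cancel ?_
      linear_combination h1 + shift (Pi.single j (-1)) ((genPolyErase (K := K) k).coeff r) *
        hd K j k * e1 - (genPolyErase (K := K) j).coeff r * e2
  have step : ∀ k, x K j * (ofU ((genPolyErase (K := K) k).coeff r) * Gam K k) =
      (ofU (shift (Pi.single j (-1)) ((genPolyErase (K := K) k).coeff r) *
        (hd K j k * Ring.inverse (hd K j k - 1))) * Gam K k +
      if k = j then ∑ l, ofU ((genPolyErase (K := K) j).coeff r *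
        Ring.inverse (1 - hd K j l)) * Gam K l - ofU ((genPolyErase (K := K) j).coeff r)
      else 0) * x K j := by
    intro k
    rw [← mul_assoc, x_mul_ofU, mul_assoc, x_mul_Gam, ← mul_assoc, mul_add, ← mul_assoc,
      ofU_mul (shift _ _)]
    congr 2
    split_ifs with hk
    · subst hk
      rw [hFj, mul_sub, mul_one, Finset.mul_sum]
      simp only [ofU_mul, mul_assoc]
    · rw [mul_zero]
  rw [Commute, SemiconjBy, c_eq hm, ← hr, mul_sub, sub_mul, Finset.mul_sum]
  simp only [step]
  rw [← Finset.sum_mul, x_mul_ofU, ← sub_mul, ← sub_mul, Finset.sum_add_distrib,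
    Finset.sum_ite_eq' Finset.univ j, if_pos (Finset.mem_univ j), hF, ofU_sub]
  congr 1
  have : ∀ k, ofU ((genPolyErase (K := K) k).coeff r) * Gam K k =
      ofU (shift (Pi.single j (-1)) ((genPolyErase (K := K) k).coeff r) *
        (hd K j k * Ring.inverse (hd K j k - 1))) * Gam K k +
      ofU ((genPolyErase (K := K) j).coeff r * Ring.inverse (1 - hd K j k)) * Gam K k := by
    intro k
    rw [← add_mul, ← ofU_add, coef]
  simp only [this, Finset.sum_add_distrib]
  abel

end DiffRelations

/-! ### `S_n` is a left and right Ore set -/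

section OreDiff

open MulOpposite

variable {K : Type*} [Field K] {n : ℕ}

theorem diff_induction {p : Diff K n → Prop} (hu : ∀ u, p (ofU u)) (hx : ∀ i, p (x K i))
    (hd : ∀ i, p (d K i)) (hmul : ∀ a b, p a → p b → p (a * b))
    (hadd : ∀ a b, p a → p b → p (a + b)) (r : Diff K n) : p r := by
  obtain ⟨f, rfl⟩ := RingQuot.mkAlgHom_surjective K (DiffRel K n) r
  induction f using FreeAlgebra.induction with
  | grade0 k => rw [AlgHom.commutes, ← ofU_algebraMap]; exact hu _
  | grade1 g =>
    cases g with
    | coeff u => exact hu u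
    | x i => exact hx i
    | d i => exact hd i
  | mul a b ha hb => rw [map_mul]; exact hmul _ _ ha hb
  | add a b ha hb => rw [map_add]; exact hadd _ _ ha hb

/-- The left module structure of `Diff_h(n)` over `Ū(n)`. -/
@[reducible] noncomputable def diffModule : Module (Ubar K n) (Diff K n) :=
  Module.compHom _ (ofUHom K n).toRingHom

/-- The right module structure of `Diff_h(n)` over `Ū(n)`. -/
@[reducible] noncomputable def diffOpModule : Module (Ubar K n) (Diff K n)ᵐᵒᵖ :=
  Module.compHom _ ((ofUHom K n).toRingHom.toOpposite fun u v => by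
    change ofU u * ofU v = ofU v * ofU u
    rw [← ofU_mul, mul_comm, ofU_mul])

theorem exists_x_mul_x (i j : Fin n) :
    ∃ b : Ubar K n, x K j * x K i = ofU b * (x K i * x K j) := by
  rcases lt_trichotomy i j with hij | rfl | hij
  · exact ⟨_, x_mul_x_of_gt hij⟩
  · exact ⟨1, by rw [ofU_one, one_mul]⟩
  · exact ⟨_, x_mul_x hij⟩

theorem exists_x_mul_d {i j : Fin n} (hij : i ≠ j) :
    ∃ b : Ubar K n, IsUnit b ∧ x K j * d K i = ofU b * (d K i * x K j) := by
  rcases lt_or_gt_of_ne hij with hij | hij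
  · refine ⟨_, ?_, x_mul_d_of_gt hij⟩
    exact ((isUnit_hd hij.ne').mul (isUnit_hd_sub_two hij.ne')).mul
      (IsUnit.ringInverse ((isUnit_hd_sub_one hij.ne').pow 2))
  · exact ⟨1, isUnit_one, by rw [ofU_one, one_mul, x_mul_d_of_lt hij]⟩

theorem Gam_mul_x_of_ne {j k : Fin n} (hkj : k ≠ j) :
    Gam K k * x K j = x K j * (Gam K k * ofU (shift (Pi.single j 1)
      (Ring.inverse (hd K j k * Ring.inverse (hd K j k - 1))))) := by
  have hu : IsUnit (hd K j k * Ring.inverse (hd K j k - 1)) :=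
    (isUnit_hd hkj.symm).mul (IsUnit.ringInverse (isUnit_hd_sub_one hkj.symm))
  have := x_mul_Gam_of_ne (K := K) hkj
  rw [mul_assoc] at this
  rw [eq_ofU_inverse_mul hu this, ← mul_assoc, ofU_mul_x, mul_assoc, (ofU_commute_Gam k _).eq]

/-- Among the generators, only `∂̄_j` fails to commute with `x^j` up to a coefficient. One factor
`x^j` moves it into the `Ū(n)`-span of `1` and the `Γ_k`, which is adapted by `x_mul_Gam`. -/
theorem adaptedElem_x (j : Fin n) (r : Diff K n) :
    letI := diffModule (K := K) (n := n)
    AdaptedElem (Ubar K n) (x K j) r := by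
  let := diffModule (K := K) (n := n)
  have sm : ∀ (u : Ubar K n) (r : Diff K n), u • r = ofU u * r := fun _ _ => rfl
  have : IsScalarTower (Ubar K n) (Diff K n) (Diff K n) :=
    ⟨fun u a b => by simp only [sm, smul_eq_mul, mul_assoc]⟩
  have hB : ∀ b : Ubar K n, ∃ b' : Ubar K n, x K j * (b • (1 : Diff K n)) = b' • x K j :=
    fun b => ⟨_, by rw [sm, mul_one, x_mul_ofU, ← sm]⟩
  have single : ∀ v : Diff K n, (∃ w, HasWeight (ofUHom K n) w v) →
      (∃ b : Ubar K n, x K j * v = ofU b * (v * x K j)) →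
      AdaptedElem (Ubar K n) (x K j) v := fun v ⟨w, hw⟩ h =>
    (adapted_span_singleton hB (fun b => ⟨shift (-w) b, by
      rw [sm, mul_one, sm]; exact hw.mul_coeff b⟩) h).adaptedElem
      (Submodule.mem_span_singleton_self _)
  induction r using diff_induction with
  | hu u =>
    refine ⟨0, _, adapted_span_pow hB 0, ?_⟩
    rw [pow_zero, one_mul, ← mul_one (ofU u)]
    exact Submodule.smul_mem _ _ (Submodule.mem_span_singleton_self _)
  | hx i => exact single _ ⟨_, hasWeight_x i⟩ (exists_x_mul_x i j)
  | hd i =>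
    by_cases hij : i = j
    · subst hij
      set F : Set (Diff K n) := insert 1 (Set.range (Gam K))
      have m1 : (1 : Diff K n) ∈ Submodule.span (Ubar K n) F :=
        Submodule.subset_span (Set.mem_insert _ _)
      have mG : ∀ k, Gam K k ∈ Submodule.span (Ubar K n) F := fun k =>
        Submodule.subset_span (Set.mem_insert_of_mem _ ⟨k, rfl⟩)
      have mS : ∑ l, ofU (Ring.inverse (1 - HDeformed.hd K i l)) * Gam K l - 1 ∈
          Submodule.span (Ubar K n) F :=
        sub_mem (sum_mem fun l _ => Submodule.smul_mem _ _ (mG l)) m1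
      refine ⟨1, _, adapted_span F ((Set.finite_range _).insert _) hB ?_ ?_, ?_⟩
      · rintro _ (rfl | ⟨k, rfl⟩) b
        · rw [one_mul]; exact Submodule.smul_mem _ _ m1
        · rw [sm, mul_one, ← (ofU_commute_Gam k b).eq]; exact Submodule.smul_mem _ _ (mG k)
      · rintro _ (rfl | ⟨k, rfl⟩)
        · exact ⟨1, m1, by simp⟩
        · refine ⟨_, ?_, x_mul_Gam i k⟩
          refine add_mem (Submodule.smul_mem _ _ (mG k)) ?_
          split_ifs
          · exact mS
          · exact zero_mem _
      · rw [pow_one, x_mul_d_self]; exact mS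
    · obtain ⟨b, -, hb⟩ := exists_x_mul_d (K := K) hij
      exact single _ ⟨_, hasWeight_d i⟩ ⟨b, hb⟩
  | hmul a b ha hb => exact ha.mul hB hb
  | hadd a b ha hb => exact ha.add hB hb

theorem adaptedElem_op_x (j : Fin n) (r : Diff K n) :
    letI := diffOpModule (K := K) (n := n)
    AdaptedElem (Ubar K n) (op (x K j)) (op r) := by
  let := diffOpModule (K := K) (n := n)
  have sm : ∀ (u : Ubar K n) (r : Diff K n), u • op r = op (r * ofU u) := fun _ _ => rfl
  have : IsScalarTower (Ubar K n) (Diff K n)ᵐᵒᵖ (Diff K n)ᵐᵒᵖ :=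
    ⟨fun u a b => mul_assoc (op (ofU u)) a b⟩
  have sm1 : ∀ u : Ubar K n, u • (1 : (Diff K n)ᵐᵒᵖ) = op (ofU u) := fun u => by
    rw [← op_one, sm, one_mul]
  have hB : ∀ b : Ubar K n, ∃ b' : Ubar K n,
      op (x K j) * (b • (1 : (Diff K n)ᵐᵒᵖ)) = b' • op (x K j) :=
    fun b => ⟨_, by rw [sm1, ← op_mul, ofU_mul_x, ← sm]⟩
  have single : ∀ v : Diff K n, (∃ w, HasWeight (ofUHom K n) w v) →
      (∃ b : Ubar K n, v * x K j = x K j * v * ofU b) →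
      AdaptedElem (Ubar K n) (op (x K j)) (op v) := fun v ⟨w, hw⟩ ⟨b, h⟩ =>
    (adapted_span_singleton hB (fun b => ⟨shift w b, by
      rw [sm1, ← op_mul, sm]; exact congrArg op (hw b)⟩)
      ⟨b, by rw [← op_mul, h, ← sm, op_mul]⟩).adaptedElem
      (Submodule.mem_span_singleton_self _)
  have conj : ∀ (a : Diff K n) (b : Ubar K n), (∃ w, HasWeight (ofUHom K n) w a) →
      ∃ b' : Ubar K n, ofU b * a = a * ofU b' := fun a b ⟨w, hw⟩ => ⟨_, hw b⟩
  induction r using diff_induction with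
  | hu u =>
    refine ⟨0, _, adapted_span_pow hB 0, ?_⟩
    rw [pow_zero, one_mul, ← sm1]
    exact Submodule.smul_mem _ _ (Submodule.mem_span_singleton_self _)
  | hx i =>
    obtain ⟨b, hb⟩ := exists_x_mul_x (K := K) j i
    obtain ⟨b', hb'⟩ := conj _ b ⟨_, (hasWeight_x j).mul (hasWeight_x i)⟩
    exact single _ ⟨_, hasWeight_x i⟩ ⟨b', by rw [hb, hb']⟩
  | hd i =>
    by_cases hij : i = j
    · subst hij
      set F : Set (Diff K n)ᵐᵒᵖ := insert 1 (Set.range fun k => op (Gam K k))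
      have m1 : (1 : (Diff K n)ᵐᵒᵖ) ∈ Submodule.span (Ubar K n) F :=
        Submodule.subset_span (Set.mem_insert _ _)
      have mG : ∀ k, op (Gam K k) ∈ Submodule.span (Ubar K n) F := fun k =>
        Submodule.subset_span (Set.mem_insert_of_mem _ ⟨k, rfl⟩)
      have mGu : ∀ k u, op (Gam K k * ofU u) ∈ Submodule.span (Ubar K n) F := fun k u =>
        Submodule.smul_mem _ u (mG k)
      have ne : ∀ k, k ≠ i → ∀ u : Ubar K n, ∃ v' ∈ Submodule.span (Ubar K n) F,
          op (ofU u * Gam K k * x K i) = v' * op (x K i) := by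
        intro k hk u
        rw [(ofU_commute_Gam k u).eq, mul_assoc, ofU_mul_x, ← mul_assoc, Gam_mul_x_of_ne hk,
          mul_assoc, mul_assoc, ← ofU_mul, op_mul]
        exact ⟨_, mGu _ _, rfl⟩
      refine ⟨1, _, adapted_span F ((Set.finite_range _).insert _) hB ?_ ?_, ?_⟩
      · rintro _ (rfl | ⟨k, rfl⟩) b
        · rw [one_mul]; exact Submodule.smul_mem _ _ m1
        · rw [sm1, ← op_mul, (ofU_commute_Gam k b).eq]; exact mGu _ _
      · rintro _ (rfl | ⟨k, rfl⟩)
        · exact ⟨1, m1, by simp⟩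
        · by_cases hk : k = i
          · subst hk
            have hs := x_mul_Gam_self (K := K) k
            rw [← Finset.add_sum_erase _ _ (Finset.mem_univ k), HDeformed.hd_self, sub_zero,
              Ring.inverse_one, ofU_one, one_mul, sub_mul, add_mul, Finset.sum_mul, one_mul] at hs
            -- On this side the relation must be solved for `Γ_k x^k`. The diagonal coefficient is
            -- `1`, and each `Γ_l x^k` with `l ≠ k` can be rewritten with `x^k` on the left.
            have hs' : Gam K k * x K k = x K k * (Gam K k + 1) -
                ∑ l ∈ Finset.univ.erase k,
                  ofU (Ring.inverse (1 - HDeformed.hd K k l)) * Gam K l * x K k := by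
              rw [mul_add, hs, mul_one]; abel
            have hsum : ∃ v' ∈ Submodule.span (Ubar K n) F,
                op (∑ l ∈ Finset.univ.erase k,
                  ofU (Ring.inverse (1 - HDeformed.hd K k l)) * Gam K l * x K k) =
                  v' * op (x K k) := by
              choose! v hv hv' using fun l (hl : l ∈ Finset.univ.erase k) =>
                ne l (Finset.ne_of_mem_erase hl) (Ring.inverse (1 - HDeformed.hd K k l))
              refine ⟨∑ l ∈ Finset.univ.erase k, v l, sum_mem hv, ?_⟩
              rw [Finset.op_sum, Finset.sum_mul]
              exact Finset.sum_congr rfl hv'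
            obtain ⟨v, hv, hv'⟩ := hsum
            refine ⟨op (Gam K k + 1) - v, sub_mem (add_mem (mG k) m1) hv, ?_⟩
            rw [← op_mul, hs', op_sub, hv', sub_mul, op_mul]
          · obtain ⟨v, hv, hv'⟩ := ne k hk 1
            rw [ofU_one, one_mul, op_mul] at hv'
            exact ⟨v, hv, hv'⟩
      · rw [pow_one, ← op_mul]; exact mG i
    · obtain ⟨b, hbu, hb⟩ := exists_x_mul_d (K := K) hij
      obtain ⟨b', hb'⟩ := conj _ (Ring.inverse b) ⟨_, (hasWeight_x j).mul (hasWeight_d i)⟩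
      exact single _ ⟨_, hasWeight_d i⟩ ⟨b', by rw [eq_ofU_inverse_mul hbu hb, hb']⟩
  | hmul a b ha hb => rw [op_mul]; exact hb.mul hB ha
  | hadd a b ha hb => rw [op_add]; exact ha.add hB hb

theorem nonempty_oreSet_S : Nonempty (OreLocalization.OreSet (S K n)) := by
  let := diffModule (K := K) (n := n)
  have : IsScalarTower (Ubar K n) (Diff K n) (Diff K n) :=
    ⟨fun u a b => mul_assoc (ofU u) a b⟩
  refine nonempty_oreSet_closure _ ?_ ?_
  · rintro _ (⟨j, rfl⟩ | ⟨i, j, k, hij, rfl⟩) r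
    · obtain ⟨m, r', h⟩ := (adaptedElem_x j r).exists_pow_mul_eq
      exact ⟨_, pow_mem (x_mem_S K j) m, r', h⟩
    · obtain ⟨u, hu⟩ := isUnit_ofU (isUnit_hd_add K hij k)
      exact ⟨1, one_mem _, r * ↑u⁻¹, by rw [← hu, one_mul, Units.inv_mul_cancel_right]⟩
  · rintro _ (⟨j, rfl⟩ | ⟨i, j, k, hij, rfl⟩) r hr
    · obtain ⟨m, h⟩ := (adaptedElem_x j r).exists_pow_mul_eq_zero hr
      exact ⟨_, pow_mem (x_mem_S K j) m, h⟩
    · rw [(isUnit_ofU (isUnit_hd_add K hij k)).mul_left_eq_zero] at hr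
      exact ⟨1, one_mem _, by rw [hr, mul_zero]⟩

theorem nonempty_oreSet_S_op : Nonempty (OreLocalization.OreSet (S K n).op) := by
  let := diffOpModule (K := K) (n := n)
  have : IsScalarTower (Ubar K n) (Diff K n)ᵐᵒᵖ (Diff K n)ᵐᵒᵖ :=
    ⟨fun u a b => mul_assoc (op (ofU u)) a b⟩
  have hx : ∀ (j : Fin n) (m : ℕ), op (x K j) ^ m ∈ (S K n).op := fun j m =>
    pow_mem (show op (x K j) ∈ (S K n).op from x_mem_S K j) m
  rw [S, Submonoid.op_closure] at *
  refine nonempty_oreSet_closure _ ?_ ?_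
  · intro g hg r
    induction r using MulOpposite.rec' with | _ r
    induction g using MulOpposite.rec' with | _ g
    obtain ⟨j, rfl⟩ | ⟨i, j, k, hij, rfl⟩ := hg
    · obtain ⟨m, r', h⟩ := (adaptedElem_op_x j r).exists_pow_mul_eq
      exact ⟨_, hx j m, r', h⟩
    · obtain ⟨u, hu⟩ := isUnit_ofU (isUnit_hd_add K hij k)
      refine ⟨1, one_mem _, op (↑u⁻¹ * r), ?_⟩
      rw [← hu, one_mul, ← op_mul, Units.mul_inv_cancel_left]
  · intro g hg r hr
    induction r using MulOpposite.rec' with | _ r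
    induction g using MulOpposite.rec' with | _ g
    obtain ⟨j, rfl⟩ | ⟨i, j, k, hij, rfl⟩ := hg
    · obtain ⟨m, h⟩ := (adaptedElem_op_x j r).exists_pow_mul_eq_zero hr
      exact ⟨_, hx j m, h⟩
    · rw [← op_mul, op_eq_zero_iff,
        (isUnit_ofU (isUnit_hd_add K hij k)).mul_right_eq_zero] at hr
      exact ⟨1, one_mem _, by rw [hr, op_zero, mul_zero]⟩

end OreDiff

/-! ### `T` is a left and right Ore set -/

section OreWeyl

open MulOpposite

variable {K : Type*} [Field K] {n : ℕ}

theorem weyl_induction {p : Weyl K n → Prop} (hk : ∀ k, p (algebraMap K _ k))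
    (hX : ∀ i, p (WX K i)) (hD : ∀ i, p (WD K i)) (hmul : ∀ a b, p a → p b → p (a * b))
    (hadd : ∀ a b, p a → p b → p (a + b)) (r : Weyl K n) : p r := by
  obtain ⟨f, rfl⟩ := RingQuot.mkAlgHom_surjective K (WeylRel K n) r
  induction f using FreeAlgebra.induction with
  | grade0 k => rw [AlgHom.commutes]; exact hk _
  | grade1 g =>
    cases g with
    | X i => exact hX i
    | D i => exact hD i
  | mul a b ha hb => rw [map_mul]; exact hmul _ _ ha hb
  | add a b ha hb => rw [map_add]; exact hadd _ _ ha hb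

theorem WX_mul_WX (i j : Fin n) : WX K i * WX K j = WX K j * WX K i := by
  have := RingQuot.mkAlgHom_rel K (WeylRel.X_X (K := K) i j)
  simp only [map_mul] at this
  exact this

theorem WD_mul_WD (i j : Fin n) : WD K i * WD K j = WD K j * WD K i := by
  have := RingQuot.mkAlgHom_rel K (WeylRel.D_D (K := K) i j)
  simp only [map_mul] at this
  exact this

theorem WD_mul_WX (i j : Fin n) :
    WD K i * WX K j = (if i = j then 1 else 0) + WX K j * WD K i := by
  have := RingQuot.mkAlgHom_rel K (WeylRel.D_X (K := K) i j)
  simp only [map_mul, map_add, apply_ite (RingQuot.mkAlgHom K (WeylRel K n)), map_one,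
    map_zero] at this
  exact this

theorem WX_mem_T (j : Fin n) : WX K j ∈ T K n := Submonoid.subset_closure (Or.inl ⟨j, rfl⟩)

theorem mem_T {j k : Fin n} (hjk : j < k) (l : ℤ) :
    WX K j * WD K j - WX K k * WD K k + (l : Weyl K n) ∈ T K n :=
  Submonoid.subset_closure (Or.inr ⟨j, k, l, hjk, rfl⟩)

/-- Only `D_j` does not commute with `X^j`; one factor `X^j` moves it into the span of `1` and `X^j
D_j`, where `X (XD) = (XD - 1) X`. -/
theorem adaptedElem_WX (j : Fin n) (r : Weyl K n) : AdaptedElem K (WX K j) r := by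
  have hB : ∀ b : K, ∃ b' : K, WX K j * (b • (1 : Weyl K n)) = b' • WX K j :=
    fun b => ⟨b, by simp⟩
  have single : ∀ v : Weyl K n, WX K j * v = v * WX K j → AdaptedElem K (WX K j) v :=
    fun v h => (adapted_span_singleton hB (fun b => ⟨b, by simp⟩)
      ⟨1, by rw [h, one_smul]⟩).adaptedElem (Submodule.mem_span_singleton_self _)
  induction r using weyl_induction with
  | hk k => exact single _ (Algebra.commutes k _).symm
  | hX i => exact single _ (WX_mul_WX _ _)
  | hD i =>
    by_cases hij : i = j
    · subst hij
      have h1 := WD_mul_WX (K := K) i i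
      rw [if_pos rfl] at h1
      refine ⟨1, _, adapted_span {1, WX K i * WD K i} (by simp) hB ?_ ?_, ?_⟩
      · intro v hv b
        rw [mul_smul_comm, mul_one]
        exact Submodule.smul_mem _ _ (Submodule.subset_span hv)
      · rintro _ (rfl | rfl)
        · exact ⟨1, Submodule.subset_span (by simp), by simp⟩
        · refine ⟨WX K i * WD K i - 1, sub_mem (Submodule.subset_span (by simp))
            (Submodule.subset_span (by simp)), ?_⟩
          rw [sub_mul, mul_assoc (WX K i) (WD K i), h1, mul_add]; simp
      · rw [pow_one]; exact Submodule.subset_span (by simp)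
    · have := WD_mul_WX (K := K) i j
      rw [if_neg hij, zero_add] at this
      exact single _ this.symm
  | hmul a b ha hb => exact ha.mul hB hb
  | hadd a b ha hb => exact ha.add hB hb

theorem adaptedElem_op_WX (j : Fin n) (r : Weyl K n) :
    AdaptedElem K (op (WX K j)) (op r) := by
  have hB : ∀ b : K, ∃ b' : K, op (WX K j) * (b • (1 : (Weyl K n)ᵐᵒᵖ)) = b' • op (WX K j) :=
    fun b => ⟨b, by rw [mul_smul_comm, mul_one]⟩
  have single : ∀ v : Weyl K n, WX K j * v = v * WX K j →
      AdaptedElem K (op (WX K j)) (op v) :=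
    fun v h => (adapted_span_singleton hB (fun b => ⟨b, by rw [mul_smul_comm, mul_one]⟩)
      ⟨1, by rw [← op_mul, ← h, one_smul, op_mul]⟩).adaptedElem
        (Submodule.mem_span_singleton_self _)
  induction r using weyl_induction with
  | hk k => exact single _ (Algebra.commutes k _).symm
  | hX i => exact single _ (WX_mul_WX _ _)
  | hD i =>
    by_cases hij : i = j
    · subst hij
      have h1 := WD_mul_WX (K := K) i i
      rw [if_pos rfl] at h1
      refine ⟨1, _, adapted_span {1, op (WD K i * WX K i)} (by simp) hB ?_ ?_, ?_⟩
      · intro v hv b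
        rw [mul_smul_comm, mul_one]
        exact Submodule.smul_mem _ _ (Submodule.subset_span hv)
      · rintro _ (rfl | rfl)
        · exact ⟨1, Submodule.subset_span (by simp), by simp⟩
        · refine ⟨op (WD K i * WX K i) + 1, add_mem (Submodule.subset_span (by simp))
            (Submodule.subset_span (by simp)), ?_⟩
          rw [← op_one, ← op_add, ← op_mul, ← op_mul]
          congr 1
          nth_rewrite 1 [h1]
          rw [add_mul, one_mul, mul_add, mul_one, mul_assoc, add_comm]
      · rw [pow_one, ← op_mul]; exact Submodule.subset_span (by simp)
    · have := WD_mul_WX (K := K) i j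
      rw [if_neg hij, zero_add] at this
      exact single _ this.symm
  | hmul a b ha hb => rw [op_mul]; exact hb.mul hB ha
  | hadd a b ha hb => rw [op_add]; exact ha.add hB hb

/-- The Euler operator `X^j D_j`. -/
noncomputable def euler (K : Type*) [Field K] {n : ℕ} (j : Fin n) : Weyl K n := WX K j * WD K j

theorem euler_mul_WX (i j : Fin n) :
    euler K i * WX K j = WX K j * (euler K i + if i = j then 1 else 0) := by
  rw [euler, mul_assoc, WD_mul_WX, mul_add, mul_add, ← mul_assoc, WX_mul_WX i j, mul_assoc,
    add_comm]
  split_ifs with hij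
  · rw [hij]
  · simp

theorem euler_mul_WD (i j : Fin n) :
    euler K i * WD K j = WD K j * (euler K i - if i = j then 1 else 0) := by
  have := WD_mul_WX (K := K) j i
  rw [mul_sub, euler, ← mul_assoc, this, add_mul, mul_assoc, WD_mul_WD, mul_assoc]
  by_cases hij : i = j
  · subst hij; simp
  · simp [hij, Ne.symm hij]

/-- The `X^i` and `D_i` are eigenvectors, and sums of products of eigenvectors form a subring. Since
`T` contains every integer shift `ℓ`, the products supplied by `exists_shift_prod_mul` stay in `T`.
-/
theorem mem_adEigen_euler (j k : Fin n) (l : ℤ) (r : Weyl K n) :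
    r ∈ (adEigen (euler K j - euler K k + (l : Weyl K n))).subsemiringClosure := by
  set t := euler K j - euler K k + (l : Weyl K n)
  have mem : ∀ v, v ∈ adEigen t → v ∈ (adEigen t).subsemiringClosure := fun v hv =>
    (Submonoid.subsemiringClosure_mem _).2 (AddSubmonoid.subset_closure hv)
  induction r using weyl_induction with
  | hk k => exact mem _ ⟨0, by rw [Int.cast_zero, add_zero, Algebra.commutes]⟩
  | hX i =>
    refine mem _ ⟨(if j = i then 1 else 0) - (if k = i then 1 else 0), ?_⟩
    simp only [t, add_mul, sub_mul, euler_mul_WX, Int.cast_comm]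
    push_cast
    simp only [mul_add, mul_sub]
    abel
  | hD i =>
    refine mem _ ⟨(if k = i then 1 else 0) - (if j = i then 1 else 0), ?_⟩
    simp only [t, add_mul, sub_mul, euler_mul_WD, Int.cast_comm]
    push_cast
    simp only [mul_add, mul_sub]
    abel
  | hmul a b ha hb => exact mul_mem ha hb
  | hadd a b ha hb => exact add_mem ha hb

/-- Passing to the opposite ring reverses the commutator, so eigenvalues change sign. -/
theorem adEigen_op {R : Type*} [Ring R] (t r : R) (hr : r ∈ (adEigen t).subsemiringClosure) :
    op r ∈ (adEigen (op t)).subsemiringClosure := by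
  rw [Submonoid.subsemiringClosure_mem] at hr ⊢
  induction hr using AddSubmonoid.closure_induction with
  | mem v hv =>
    obtain ⟨w, hw⟩ := hv
    refine AddSubmonoid.subset_closure ⟨-w, ?_⟩
    rw [mul_add] at hw
    rw [mul_add, ← op_mul, ← op_mul, hw, op_add, Int.cast_neg, ← op_intCast, mul_neg, ← op_mul,
      Int.cast_comm]
    abel
  | zero => exact zero_mem _
  | add a b _ _ ha hb => rw [op_add]; exact add_mem ha hb

theorem prod_mem_T {j k : Fin n} (hjk : j < k) (l : ℤ) (ws : List ℤ) :
    (ws.map fun w : ℤ => euler K j - euler K k + (l : Weyl K n) + (w : Weyl K n)).prod ∈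
      T K n := by
  refine Submonoid.list_prod_mem _ fun y hy => ?_
  obtain ⟨w, -, rfl⟩ := List.mem_map.1 hy
  have := mem_T (K := K) hjk (l + w)
  rw [Int.cast_add, ← add_assoc] at this
  exact this

theorem nonempty_oreSet_T : Nonempty (OreLocalization.OreSet (T K n)) := by
  refine nonempty_oreSet_closure _ ?_ ?_
  · rintro _ (⟨j, rfl⟩ | ⟨j, k, l, hjk, rfl⟩) r
    · obtain ⟨m, r', h⟩ := (adaptedElem_WX j r).exists_pow_mul_eq
      exact ⟨_, pow_mem (WX_mem_T j) m, r', h⟩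
    · obtain ⟨ws, r', -, h⟩ := exists_shift_prod_mul _ r (mem_adEigen_euler j k l r)
      exact ⟨_, prod_mem_T hjk l ws, r', h⟩
  · rintro _ (⟨j, rfl⟩ | ⟨j, k, l, hjk, rfl⟩) r hr
    · obtain ⟨m, h⟩ := (adaptedElem_WX j r).exists_pow_mul_eq_zero hr
      exact ⟨_, pow_mem (WX_mem_T j) m, h⟩
    · obtain ⟨ws, r', h0, h⟩ := exists_shift_prod_mul _ r (mem_adEigen_euler j k l r)
      exact ⟨_, prod_mem_T hjk l ws, by rw [h]; exact h0 hr⟩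

theorem op_prod_mem_T {j k : Fin n} (hjk : j < k) (l : ℤ) (ws : List ℤ) :
    (ws.map fun w : ℤ => op (euler K j - euler K k + (l : Weyl K n)) +
      (w : (Weyl K n)ᵐᵒᵖ)).prod ∈ (T K n).op := by
  refine Submonoid.list_prod_mem _ fun y hy => ?_
  obtain ⟨w, -, rfl⟩ := List.mem_map.1 hy
  have := mem_T (K := K) hjk (l + w)
  rw [Int.cast_add, ← add_assoc] at this
  exact this

theorem nonempty_oreSet_T_op : Nonempty (OreLocalization.OreSet (T K n).op) := by
  have hX : ∀ (j : Fin n) (m : ℕ), op (WX K j) ^ m ∈ (T K n).op := fun j m =>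
    pow_mem (show op (WX K j) ∈ (T K n).op from WX_mem_T j) m
  have hp := @op_prod_mem_T K _ n
  rw [T, Submonoid.op_closure] at *
  refine nonempty_oreSet_closure _ ?_ ?_
  · intro g hg r
    induction r using MulOpposite.rec' with | _ r
    induction g using MulOpposite.rec' with | _ g
    obtain ⟨j, rfl⟩ | ⟨j, k, l, hjk, rfl⟩ := hg
    · obtain ⟨m, r', h⟩ := (adaptedElem_op_WX j r).exists_pow_mul_eq
      exact ⟨_, hX j m, r', h⟩
    · obtain ⟨ws, r', -, h⟩ :=
        exists_shift_prod_mul _ (op r) (adEigen_op _ _ (mem_adEigen_euler j k l r))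
      exact ⟨_, hp hjk l ws, r', h⟩
  · intro g hg r hr
    induction r using MulOpposite.rec' with | _ r
    induction g using MulOpposite.rec' with | _ g
    obtain ⟨j, rfl⟩ | ⟨j, k, l, hjk, rfl⟩ := hg
    · obtain ⟨m, h⟩ := (adaptedElem_op_WX j r).exists_pow_mul_eq_zero hr
      exact ⟨_, hX j m, h⟩
    · obtain ⟨ws, r', h0, h⟩ :=
        exists_shift_prod_mul _ (op r) (adEigen_op _ _ (mem_adEigen_euler j k l r))
      exact ⟨_, hp hjk l ws, by rw [h]; exact h0 hr⟩

end OreWeyl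

/-! ### Homomorphisms out of localizations and polynomial rings -/

section Lifts

variable {K : Type*} [Field K]

section Ore

variable {R A : Type*} [Ring R] [Algebra K R] [Ring A] [Algebra K A]
  {M : Submonoid R} [OreLocalization.OreSet M]

variable (K M) in
/-- The canonical homomorphism to an Ore localization. -/
noncomputable def numHom : R →ₐ[K] OreLocalization M R where
  __ := OreLocalization.numeratorRingHom (S := M)
  commutes' _ := rfl

theorem numHom_apply (r : R) : numHom K M r = r /ₒ (1 : M) := rfl

theorem numHom_mul_one_div (s : M) : numHom K M (s : R) * ((1 : R) /ₒ s) = 1 := by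
  rw [numHom_apply]
  exact (OreLocalization.mul_cancel (s := s) (t := 1)).trans OreLocalization.one_def.symm

theorem one_div_mul_numHom (s : M) : ((1 : R) /ₒ s) * numHom K M (s : R) = 1 := by
  rw [numHom_apply, OreLocalization.mul_div_one, one_mul, OreLocalization.div_eq_one]

theorem exists_oreLift (f : R →ₐ[K] A) (hf : ∀ s ∈ M, IsUnit (f s)) :
    ∃ g : OreLocalization M R →ₐ[K] A, ∀ r, g (numHom K M r) = f r := by
  let fS : M →* Aˣ := IsUnit.liftRight ((f : R →* A).comp M.subtype) fun s => hf s s.2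
  have hfS : ∀ s : M, (f : R →+* A) s = fS s := fun s => rfl
  let g := OreLocalization.universalHom (f : R →+* A) fS hfS
  have hg : ∀ r, g (numHom K M r) = f r := fun r =>
    OreLocalization.universalHom_commutes (f : R →+* A) fS hfS
  have hc : ∀ k, g (algebraMap K _ k) = algebraMap K A k := fun k => by
    have := hg (algebraMap K R k)
    rw [AlgHom.commutes, AlgHom.commutes] at this
    exact this
  exact ⟨{ g with commutes' := hc }, hg⟩

/-- A fraction `r /ₒ s` is determined by `s (r /ₒ s) = r`, and the image of `s` is a unit. -/
theorem oreHom_ext {f g : OreLocalization M R →ₐ[K] A}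
    (hfg : ∀ r, f (numHom K M r) = g (numHom K M r)) : f = g := by
  ext z
  induction z using OreLocalization.ind with | _ r s
  have e : numHom K M (s : R) * (r /ₒ s) = numHom K M r := by
    rw [numHom_apply, numHom_apply]
    exact OreLocalization.mul_cancel
  have hu : IsUnit (f (numHom K M (s : R))) :=
    IsUnit.map f ⟨⟨_, _, numHom_mul_one_div s, one_div_mul_numHom s⟩, rfl⟩
  refine hu.mul_left_cancel ?_
  rw [← map_mul, e, hfg r, ← e, map_mul, hfg]

end Ore

variable {n : ℕ} {A : Type*} [Ring A] [Algebra K A]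

open scoped IsMulCommutative in
-- Polynomial evaluation wants a commutative target; the subalgebra generated by the commuting `b i`
-- provides one.
theorem exists_polyLift (b : Fin n → A) (hb : ∀ i j, Commute (b i) (b j)) :
    ∃ f : MvPolynomial (Fin n) K →ₐ[K] A, ∀ i, f (MvPolynomial.X i) = b i := by
  let C := Algebra.adjoin K (Set.range b)
  have : IsMulCommutative C := Algebra.isMulCommutative_adjoin K (by
    rintro _ ⟨i, rfl⟩ _ ⟨j, rfl⟩
    exact hb i j)
  refine ⟨C.val.comp (MvPolynomial.aeval fun i =>
    (⟨b i, Algebra.subset_adjoin ⟨i, rfl⟩⟩ : C)), fun i => ?_⟩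
  rw [AlgHom.comp_apply, MvPolynomial.aeval_X]
  rfl

/-- The target is noncommutative, so `Ū(n)` is treated as an Ore localization. -/
theorem exists_ubarLift (b : Fin n → A) (hb : ∀ i j, Commute (b i) (b j))
    (hu : ∀ (i j : Fin n) (k : ℤ), i ≠ j → IsUnit (b i - b j + (k : A))) :
    ∃ ι : Ubar K n →ₐ[K] A, ∀ i, ι (h K i) = b i := by
  obtain ⟨f, hf⟩ := exists_polyLift (K := K) b hb
  obtain ⟨g, hg⟩ := exists_oreLift (M := denominators K n) f fun s hs =>
    isUnit_map_denominators (f : U K n →+* A) (fun i j k hij => by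
      have := hu i j k hij
      rw [← hf, ← hf] at this
      exact this) hs
  exact ⟨g, fun i => (hg _).trans (hf i)⟩

theorem mvPolynomial_commute (f : MvPolynomial (Fin n) K →ₐ[K] A) (z : A)
    (hz : ∀ i, Commute (f (MvPolynomial.X i)) z) (p : MvPolynomial (Fin n) K) :
    Commute (f p) z := by
  induction p using MvPolynomial.induction_on with
  | C a =>
    have : f (MvPolynomial.C a) = algebraMap K A a := f.commutes a
    rw [this]; exact Algebra.commutes a z
  | add p q hp hq => rw [map_add]; exact hp.add_left hq
  | mul_X p i hp => rw [map_mul]; exact hp.mul_left (hz i)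

end Lifts

/-! ### Homomorphisms from the Weyl algebra and from `Diff_h(n)` -/

section Torus

variable {K : Type*} [Field K] {n : ℕ} {A : Type*} [Ring A] [Algebra K A]

/-- Commuting invertible elements `X_i` shifting `h̃_i` by one. -/
structure TorusData (ι : Ubar K n →ₐ[K] A) (X Y : Fin n → A) : Prop where
  weight : ∀ i, HasWeight ι (Pi.single i 1) (X i)
  mul_inv : ∀ i, X i * Y i = 1
  inv_mul : ∀ i, Y i * X i = 1
  comm : ∀ i j, X i * X j = X j * X i

variable {ι : Ubar K n →ₐ[K] A} {X Y : Fin n → A}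

theorem commute_of_inverse {a b z : A} (hab : a * b = 1) (hba : b * a = 1) (hz : Commute a z) :
    Commute b z := by
  have : b * (a * z) * b = b * (z * a) * b := by rw [hz.eq]
  rw [← mul_assoc, hba, one_mul, mul_assoc, mul_assoc, hab, mul_one] at this
  exact this.symm

theorem TorusData.weight_inv (t : TorusData ι X Y) (i : Fin n) :
    HasWeight ι (Pi.single i (-1)) (Y i) := by
  rw [Pi.single_neg]
  exact (t.weight i).of_isUnit (t.mul_inv i) (t.inv_mul i)

theorem TorusData.commute_inv (t : TorusData ι X Y) (i j : Fin n) : Commute (Y i) (X j) :=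
  commute_of_inverse (t.mul_inv i) (t.inv_mul i) (t.comm i j)

theorem TorusData.commute_inv_inv (t : TorusData ι X Y) (i j : Fin n) : Commute (Y i) (Y j) :=
  (commute_of_inverse (t.mul_inv j) (t.inv_mul j) (t.commute_inv i j).symm).symm

/-- The Weyl algebra maps to `A` by `X^i ↦ X_i`, `D_i ↦ X_i⁻¹ (h̃_i - 1)`. -/
theorem TorusData.exists_weylHom (t : TorusData ι X Y) :
    ∃ f : Weyl K n →ₐ[K] A, (∀ i, f (WX K i) = X i) ∧
      ∀ i, f (WD K i) = Y i * ι (h K i - 1) := by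
  let F : FreeAlgebra K (WeylGen n) →ₐ[K] A := FreeAlgebra.lift K fun g => match g with
    | WeylGen.X i => X i
    | WeylGen.D i => Y i * ι (h K i - 1)
  have FX : ∀ i, F (wX K i) = X i := fun i => FreeAlgebra.lift_ι_apply _ _
  have FD : ∀ i, F (wD K i) = Y i * ι (h K i - 1) := fun i => FreeAlgebra.lift_ι_apply _ _
  have hX : ∀ i j, ι (h K i - 1) * X j = X j * ι (h K i - 1 + if i = j then 1 else 0) := by
    intro i j
    rw [t.weight j, map_sub, shift_h, map_one, Pi.single_apply]
    push_cast
    congr 2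
    ring
  have hY : ∀ i j, i ≠ j → ι (h K i - 1) * Y j = Y j * ι (h K i - 1) := by
    intro i j hij
    rw [t.weight_inv j, map_sub, shift_h, map_one, Pi.single_apply, if_neg hij, Int.cast_zero,
      add_zero]
  have hr : ∀ ⦃a b⦄, WeylRel K n a b → F a = F b := by
    intro a b hab
    induction hab with
    | X_X i j => simp only [map_mul, FX, t.comm i j]
    | D_D i j =>
      simp only [map_mul F, FD]
      by_cases hij : i = j
      · rw [hij]
      · rw [mul_assoc, ← mul_assoc (ι _), hY i j hij, mul_assoc, ← map_mul, ← mul_assoc,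
          (t.commute_inv_inv i j).eq, mul_comm (h K i - 1), map_mul, mul_assoc,
          ← mul_assoc (Y i), ← hY j i (Ne.symm hij)]
        simp only [mul_assoc]
    -- Moving `h̃_i - 1` past `X_j` adds `δ_{ij}`, which is exactly the constant of the Weyl
    -- relation.
    | D_X i j =>
      simp only [map_mul F, map_add F, apply_ite F, map_one F, map_zero F, FX, FD]
      rw [mul_assoc, hX, ← mul_assoc, ← mul_assoc, (t.commute_inv i j).eq]
      by_cases hij : i = j
      · subst hij
        rw [if_pos rfl, if_pos rfl, t.mul_inv, one_mul, one_mul, map_add, map_one, add_comm]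
      · rw [if_neg hij, if_neg hij, add_zero, zero_add]
  exact ⟨RingQuot.liftAlgHom K ⟨F, hr⟩,
    fun i => (RingQuot.liftAlgHom_mkAlgHom_apply K F hr _).trans (FX i),
    fun i => (RingQuot.liftAlgHom_mkAlgHom_apply K F hr _).trans (FD i)⟩

/-- Elements of `A` satisfying, after inverting the `x_i`, the relations between `Ū(n)`, the
`x^i` and the `Γ_i`. -/
structure HDiffData (ι : Ubar K n →ₐ[K] A) (x y Γ : Fin n → A) : Prop where
  weight : ∀ i, HasWeight ι (Pi.single i 1) (x i)
  mul_inv : ∀ i, x i * y i = 1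
  inv_mul : ∀ i, y i * x i = 1
  x_x : ∀ i j, i < j → x i * x j = ι ((hd K i j + 1) * Ring.inverse (hd K i j)) * (x j * x i)
  weight_Γ : ∀ i, HasWeight ι 0 (Γ i)
  comm_Γ : ∀ i j, Commute (Γ i) (Γ j)
  x_Γ : ∀ j k, k ≠ j →
    x j * Γ k = ι (hd K j k * Ring.inverse (hd K j k - 1)) * Γ k * x j
  x_Γ_self : ∀ j, x j * Γ j = (∑ k, ι (Ring.inverse (1 - hd K j k)) * Γ k - 1) * x j

variable {x y Γ : Fin n → A}

theorem HDiffData.weight_inv (t : HDiffData ι x y Γ) (i : Fin n) :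
    HasWeight ι (Pi.single i (-1)) (y i) := by
  rw [Pi.single_neg]
  exact (t.weight i).of_isUnit (t.mul_inv i) (t.inv_mul i)

theorem HDiffData.y_mul_ι (t : HDiffData ι x y Γ) (i : Fin n) (u : Ubar K n) :
    y i * ι u = ι (shift (Pi.single i 1) u) * y i := by
  have := (t.weight_inv i).mul_coeff u
  rwa [← Pi.single_neg, neg_neg] at this

theorem HDiffData.y_mul_Γ (t : HDiffData ι x y Γ) {j k : Fin n} (hkj : k ≠ j) :
    y j * Γ k = ι (hd K j k * Ring.inverse (hd K j k + 1)) * Γ k * y j := by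
  have h0 := isUnit_hd (K := K) hkj.symm
  have h1 := isUnit_hd_sub_one (K := K) hkj.symm
  have h2 := isUnit_hd_add_one (K := K) hkj.symm
  have e := congrArg (fun z => y j * z * y j) (t.x_Γ j k hkj)
  rw [← mul_assoc, t.inv_mul, one_mul, mul_assoc, mul_assoc _ (x j), t.mul_inv, mul_one,
    ← mul_assoc, t.y_mul_ι, map_mul, shift_inverse _ h1, map_sub, map_one, shift_hd,
    Pi.single_eq_same, Pi.single_eq_of_ne hkj, Int.cast_one, Int.cast_zero, sub_zero,
    add_sub_cancel_right] at e
  rw [mul_assoc, e, ← mul_assoc, ← mul_assoc, ← map_mul]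
  have : hd K j k * Ring.inverse (hd K j k + 1) * ((hd K j k + 1) * Ring.inverse (hd K j k)) =
      1 := by
    have e1 := Ring.inverse_mul_cancel _ h0
    have e2 := Ring.inverse_mul_cancel _ h2
    linear_combination e1 * Ring.inverse (hd K j k + 1) * (hd K j k + 1) + e2
  rw [this, map_one, one_mul]

/-- `Diff_h(n)` maps to `A` by `∂̄_i ↦ Γ_i x_i⁻¹`. -/
theorem HDiffData.exists_diffHom (t : HDiffData ι x y Γ) :
    ∃ f : Diff K n →ₐ[K] A, (∀ u, f (ofU u) = ι u) ∧ (∀ i, f (HDeformed.x K i) = x i) ∧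
      ∀ i, f (HDeformed.d K i) = Γ i * y i := by
  let F : FreeDiff K n →ₐ[K] A := FreeAlgebra.lift K fun g => match g with
    | Gen.coeff u => ι u
    | Gen.x i => x i
    | Gen.d i => Γ i * y i
  have Fu : ∀ u, F (fu u) = ι u := fun i => FreeAlgebra.lift_ι_apply _ _
  have Fx : ∀ i, F (fx K i) = x i := fun i => FreeAlgebra.lift_ι_apply _ _
  have Fd : ∀ i, F (fd K i) = Γ i * y i := fun i => FreeAlgebra.lift_ι_apply _ _
  have dx : ∀ i, Γ i * y i * x i = Γ i := fun i => by rw [mul_assoc, t.inv_mul, mul_one]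
  have hr : ∀ ⦃a b⦄, DiffRel K n a b → F a = F b := by
    intro a b hab
    induction hab with
    | coeff_add u v => simp only [map_add, Fu]
    | coeff_mul u v => simp only [map_mul, Fu]
    | coeff_algebraMap a => rw [Fu, AlgHom.commutes, AlgHom.commutes]
    | weight_x i j =>
      simp only [map_mul F, Fu, Fx]
      rw [t.weight j, shift_h, Pi.single_apply]
      push_cast
      rfl
    | weight_d i j =>
      have w := (t.weight_Γ j).mul (t.weight_inv j)
      rw [zero_add] at w
      simp only [map_mul F, Fu, Fd]
      rw [w, shift_h, Pi.single_apply]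
      congr 2
      split_ifs <;> simp [sub_eq_add_neg]
    | x_x i j hij => simp only [map_mul F, Fu, Fx]; exact t.x_x i j hij
    -- Both sides reduce to `Γ_i Γ_j y_j y_i`: the factors from `y_mul_Γ`, from exchanging the `y`'s
    -- and from the relation itself cancel to `1`.
    | d_d i j hij =>
      have u0 := isUnit_hd (K := K) hij.ne
      have u1 := isUnit_hd_add_one (K := K) hij.ne
      have u2 := isUnit_hd_sub_one (K := K) hij.ne
      have u3 := isUnit_hd_add_one (K := K) hij.ne'
      simp only [map_mul F, Fu, Fd]
      have yy : y i * y j = ι ((hd K i j + 1) * Ring.inverse (hd K i j)) * (y j * y i) := by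
        have w := ((t.weight_inv j).mul (t.weight_inv i))
          ((hd K i j + 1) * Ring.inverse (hd K i j))
        have s : shift (Pi.single j (-1) + Pi.single i (-1)) (hd K i j) = hd K i j := by
          simp [shift_hd, hij.ne, hij.ne']
        rw [map_mul (shift _), shift_inverse _ u0, map_add, map_one, s] at w
        rw [w]
        have e := congrArg (fun z => y j * y i * z * (y i * y j)) (t.x_x i j hij)
        have e1 : y j * y i * (x i * x j) = 1 := by
          rw [mul_assoc, ← mul_assoc (y i), t.inv_mul, one_mul, t.inv_mul]
        have e2 : x j * x i * (y i * y j) = 1 := by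
          rw [mul_assoc, ← mul_assoc (x i), t.mul_inv, one_mul, t.mul_inv]
        rw [e1, one_mul, mul_assoc (y j * y i), mul_assoc (ι _), e2, mul_one] at e
        exact e
      have l1 : Γ i * y i * (Γ j * y j) =
          ι (hd K i j * Ring.inverse (hd K i j + 1)) * (Γ i * Γ j) * (y i * y j) := by
        rw [mul_assoc, ← mul_assoc (y i), t.y_mul_Γ hij.ne']
        simp only [← mul_assoc]
        rw [((t.weight_Γ i).commute _).eq]
      have l2 : Γ j * y j * (Γ i * y i) =
          ι (hd K j i * Ring.inverse (hd K j i + 1)) * (Γ i * Γ j) * (y j * y i) := by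
        rw [mul_assoc, ← mul_assoc (y j), t.y_mul_Γ hij.ne]
        simp only [← mul_assoc]
        rw [← ((t.weight_Γ j).commute _).eq, mul_assoc (ι _), (t.comm_Γ j i).eq]
        simp only [← mul_assoc]
      have cg : Commute (ι ((hd K i j + 1) * Ring.inverse (hd K i j))) (Γ i * Γ j) :=
        ((t.weight_Γ i).commute _).mul_right ((t.weight_Γ j).commute _)
      rw [l1, l2, yy, mul_assoc (ι _), ← mul_assoc (Γ i * Γ j), ← cg.eq]
      simp only [← mul_assoc, ← map_mul ι]
      congr 5
      rw [hd_neg i j]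
      have e1 := Ring.inverse_mul_cancel _ u1
      rw [hd_neg i j] at u3
      have e3 := Ring.inverse_mul_cancel _ u3
      refine u3.mul_left_cancel ?_
      linear_combination (-hd K i j + 1) * Ring.inverse (hd K i j) * hd K i j * e1
        - (-hd K i j) * (hd K i j - 1) * Ring.inverse (hd K i j) * e3
    | x_d_lt i j hij =>
      have u0 := isUnit_hd (K := K) hij.ne
      simp only [map_mul F, Fx, Fd]
      have yx : y j * x i = ι (hd K i j * Ring.inverse (hd K i j - 1)) * (x i * y j) := by
        have e := congrArg (fun z => y j * z * y j) (t.x_x i j hij)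
        rw [mul_assoc, mul_assoc (x i), t.mul_inv, mul_one, ← mul_assoc (y j), t.y_mul_ι,
          map_mul, shift_inverse _ u0, map_add, map_one, shift_hd, Pi.single_eq_same,
          Pi.single_eq_of_ne hij.ne, Int.cast_one, Int.cast_zero, add_zero, sub_add_cancel,
          mul_assoc, mul_assoc, ← mul_assoc (y j), ← mul_assoc (y j), t.inv_mul, one_mul] at e
        exact e
      rw [← mul_assoc, t.x_Γ i j hij.ne', mul_assoc (Γ j), yx, ← mul_assoc (Γ j),
        ((t.weight_Γ j).commute _).eq]
      simp only [mul_assoc]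
    -- With `z = h̃_{ij}`, exchanging `x_i` with `Γ_j` contributes `z / (z - 1)` and exchanging it
    -- with `y_j` contributes `(z - 2) / (z - 1)`.
    | x_d_gt i j hij =>
      have u0 := isUnit_hd (K := K) hij.ne
      have u1 := isUnit_hd_sub_one (K := K) hij.ne'
      have u2 := isUnit_hd_add_one (K := K) hij.ne
      simp only [map_mul F, Fu, Fx, Fd]
      have xy : x i * y j =
          ι ((hd K j i + 1 + 1) * Ring.inverse (hd K j i + 1)) * (y j * x i) := by
        have e := congrArg (fun z => y j * z * y j) (t.x_x j i hij)
        rw [← mul_assoc, t.inv_mul, one_mul, ← mul_assoc (y j), t.y_mul_ι,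
          map_mul, shift_inverse _ u0, map_add, map_one, shift_hd, Pi.single_eq_same,
          Pi.single_eq_of_ne hij.ne', Int.cast_one, Int.cast_zero, sub_zero, mul_assoc, mul_assoc,
          mul_assoc, t.mul_inv, mul_one] at e
        exact e
      rw [← mul_assoc, t.x_Γ i j hij.ne, mul_assoc (ι _ * Γ j), xy, mul_assoc (Γ j),
        mul_assoc (ι _), ← mul_assoc (Γ j), ← ((t.weight_Γ j).commute _).eq]
      simp only [← mul_assoc, ← map_mul ι]
      congr 4
      rw [hd_neg i j] at u2 ⊢
      have e1 := Ring.inverse_mul_cancel _ u1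
      have e2 := Ring.inverse_mul_cancel _ u2
      have e3 := Ring.inverse_mul_cancel _ (u1.pow 2)
      refine (u1.pow 2).mul_left_cancel ?_
      linear_combination hd K i j * (-hd K i j + 2) * Ring.inverse (-hd K i j + 1) *
        (hd K i j - 1) * e1 - hd K i j * (-hd K i j + 2) * e2 - hd K i j * (hd K i j - 2) * e3
    | x_d_eq i =>
      simp only [map_mul F, map_sub F, map_sum F, map_one F, Fu, Fx, Fd, dx]
      rw [← mul_assoc, t.x_Γ_self, mul_assoc, t.mul_inv, mul_one]
  exact ⟨RingQuot.liftAlgHom K ⟨F, hr⟩,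
    fun i => (RingQuot.liftAlgHom_mkAlgHom_apply K F hr _).trans (Fu i),
    fun i => (RingQuot.liftAlgHom_mkAlgHom_apply K F hr _).trans (Fx i),
    fun i => (RingQuot.liftAlgHom_mkAlgHom_apply K F hr _).trans (Fd i)⟩

end Torus

/-! ### Reconstruction of the `Γ_k` from the central elements -/

section Reconstruct

variable {K : Type*} [Field K] {n : ℕ} {A : Type*} [Ring A] [Algebra K A]
  {ι : Ubar K n →ₐ[K] A} {X Y : Fin n → A}

variable (ι) in
/-- `Γ_k` in terms of the values `a_1, …, a_n` of the central elements. -/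
noncomputable def gamOf (a : Fin n → A) (k : Fin n) : A :=
  ∑ m : Fin n, ι (lagCoeff k (n - (m + 1))) * a m - ι (lagCoeff k n)

theorem sum_fin_reflect {M : Type*} [AddCommMonoid M] (f : ℕ → M) :
    ∑ m : Fin n, f (n - (m + 1)) = ∑ r ∈ Finset.range n, f r := by
  rw [Fin.sum_univ_eq_sum_range fun m => f (n - (m + 1)), ← Finset.sum_range_reflect]
  refine Finset.sum_congr rfl fun m hm => ?_
  rw [Finset.mem_range] at hm
  congr 1
  omega

theorem isUnit_of_inverse {a b : A} (hab : a * b = 1) (hba : b * a = 1) : IsUnit a :=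
  ⟨⟨a, b, hab, hba⟩, rfl⟩

theorem ι_commute (ι : Ubar K n →ₐ[K] A) (u v : Ubar K n) : Commute (ι u) (ι v) := by
  rw [Commute, SemiconjBy, ← map_mul, mul_comm, map_mul]

theorem shift_psi' {i j : Fin n} (hij : i < j) (w : ℤ) :
    shift (Pi.single j w) (psi' K i) = psi' K i := by
  rw [psi', map_prod]
  refine Finset.prod_congr rfl fun k hk => ?_
  have hk := (Finset.mem_filter.1 hk).2
  simp [shift_hd, hij.ne, (hk.trans hij).ne]

/-- Only the factor `h̃_{ji}` of `ψ'_j` moves. The resulting ratio `(h̃_{ij} + 1) / h̃_{ij}` is the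
coefficient in the relation between `x^i` and `x^j`, which is why the rescaling by `ψ'` makes them
commute. -/
theorem shift_psi'_of_lt {i j : Fin n} (hij : i < j) :
    hd K j i * shift (Pi.single i 1) (psi' K j) = (hd K j i - 1) * psi' K j := by
  have hmem : i ∈ Finset.univ.filter (fun k => k < j) := by simpa using hij
  rw [psi', map_prod, ← Finset.mul_prod_erase _ _ hmem, ← Finset.mul_prod_erase _ _ hmem]
  have : ∏ k ∈ (Finset.univ.filter (fun k => k < j)).erase i,
      shift (Pi.single i 1) (hd K j k) =
      ∏ k ∈ (Finset.univ.filter (fun k => k < j)).erase i, hd K j k := by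
    refine Finset.prod_congr rfl fun k hk => ?_
    simp [shift_hd, hij.ne', Finset.ne_of_mem_erase hk]
  rw [this]
  simp [shift_hd, hij.ne']
  ring

theorem mul_gamOf {j : Fin n} {z : A} (hz : HasWeight ι (Pi.single j 1) z) (a : Fin n → A)
    (ha : ∀ i, Commute (a i) z) (k : Fin n) :
    z * gamOf ι a k = (∑ m : Fin n, ι (shift (Pi.single j (-1)) (lagCoeff k (n - (m + 1)))) * a m -
      ι (shift (Pi.single j (-1)) (lagCoeff k n))) * z := by
  have h1 : ∀ u, z * ι u = ι (shift (Pi.single j (-1)) u) * z := fun u => by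
    rw [hz.mul_coeff u, Pi.single_neg]
  rw [gamOf, mul_sub, Finset.mul_sum, sub_mul, Finset.sum_mul, h1]
  congr 1
  refine Finset.sum_congr rfl fun m _ => ?_
  rw [← mul_assoc, h1, mul_assoc, ← (ha m).eq, mul_assoc]

theorem mul_gamOf_of_ne {j k : Fin n} (hkj : k ≠ j) {z : A} (hz : HasWeight ι (Pi.single j 1) z)
    (a : Fin n → A) (ha : ∀ i, Commute (a i) z) :
    z * gamOf ι a k = ι (hd K j k * Ring.inverse (hd K j k - 1)) * gamOf ι a k * z := by
  have u1 := isUnit_hd_sub_one (K := K) hkj.symm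
  have h1 : ∀ r, shift (Pi.single j (-1)) (lagCoeff k r) =
      hd K j k * Ring.inverse (hd K j k - 1) * lagCoeff k r := by
    intro r
    have e1 := Ring.inverse_mul_cancel _ u1
    refine u1.mul_left_cancel ?_
    linear_combination shift_lagCoeff (K := K) hkj r - hd K j k * lagCoeff k r * e1
  rw [mul_gamOf hz a ha, gamOf, mul_sub, Finset.mul_sum]
  simp only [h1, map_mul ι, mul_assoc]

/-- The coefficients match by `sum_inverse_mul_lagCoeff`; its exceptional case `r = n`, met in the
constant term, yields the `-1`. -/
theorem mul_gamOf_self {j : Fin n} {z : A} (hz : HasWeight ι (Pi.single j 1) z)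
    (a : Fin n → A) (ha : ∀ i, Commute (a i) z) :
    z * gamOf ι a j =
      (∑ k, ι (Ring.inverse (1 - hd K j k)) * gamOf ι a k - 1) * z := by
  rw [mul_gamOf hz a ha]
  congr 1
  have h1 : ∀ r, r < n → shift (Pi.single j (-1)) (lagCoeff j r) =
      ∑ k, Ring.inverse (1 - hd K j k) * lagCoeff k r := by
    intro r hr
    rw [sum_inverse_mul_lagCoeff j r hr.le, if_neg hr.ne, sub_zero]
  have h2 : shift (Pi.single j (-1)) (lagCoeff j n) =
      ∑ k, Ring.inverse (1 - hd K j k) * lagCoeff k n + 1 := by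
    rw [sum_inverse_mul_lagCoeff j n le_rfl, if_pos rfl, sub_add_cancel]
  have h3 : ∀ m : Fin n, ι (shift (Pi.single j (-1)) (lagCoeff j (n - (m + 1)))) * a m =
      ∑ k, ι (Ring.inverse (1 - hd K j k)) * (ι (lagCoeff k (n - (m + 1))) * a m) := by
    intro m
    have hm := m.2
    rw [h1 _ (by omega), map_sum, Finset.sum_mul]
    simp only [map_mul, mul_assoc]
  simp only [h3, gamOf, mul_sub, Finset.sum_sub_distrib, Finset.mul_sum]
  rw [Finset.sum_comm, h2, map_add, map_one, map_sum]
  simp only [map_mul]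
  abel

/-- In a torus with central elements `a_m` there are elements satisfying the relations of
`Diff_h(n)`. -/
theorem TorusData.hDiffData (t : TorusData ι X Y) (a : Fin n → A)
    (ha : ∀ i j, Commute (a i) (a j)) (haι : ∀ i u, Commute (a i) (ι u))
    (haX : ∀ i j, Commute (a i) (X j)) :
    HDiffData ι (fun i => X i * ι (Ring.inverse (psi' K i))) (fun i => ι (psi' K i) * Y i)
      (gamOf ι a) where
  weight i := by
    have := (t.weight i).mul (hasWeight_coeff (ι := ι) (Ring.inverse (psi' K i)))
    rwa [add_zero] at this
  mul_inv i := by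
    rw [mul_assoc, ← mul_assoc (ι _), ← map_mul, Ring.inverse_mul_cancel _ (isUnit_psi' i),
      map_one, one_mul, t.mul_inv]
  inv_mul i := by
    rw [mul_assoc, ← mul_assoc (Y i), t.inv_mul, one_mul, ← map_mul,
      Ring.mul_inverse_cancel _ (isUnit_psi' i), map_one]
  x_x i j hij := by
    have u0 := isUnit_hd (K := K) hij.ne
    have pi := isUnit_psi' (K := K) i
    have pj := isUnit_psi' (K := K) j
    have l1 : X i * ι (Ring.inverse (psi' K i)) * (X j * ι (Ring.inverse (psi' K j))) =
        X i * X j * ι (Ring.inverse (psi' K i) * Ring.inverse (psi' K j)) := by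
      rw [mul_assoc, ← mul_assoc (ι _), t.weight j, shift_inverse _ pi, shift_psi' hij, map_mul]
      simp only [mul_assoc]
    have l2 : X j * ι (Ring.inverse (psi' K j)) * (X i * ι (Ring.inverse (psi' K i))) =
        X i * X j * ι (Ring.inverse (shift (Pi.single i 1) (psi' K j)) *
          Ring.inverse (psi' K i)) := by
      rw [mul_assoc, ← mul_assoc (ι _), t.weight i, shift_inverse _ pj, map_mul, t.comm i j]
      simp only [mul_assoc]
    have w := ((t.weight i).mul (t.weight j)) ((hd K i j + 1) * Ring.inverse (hd K i j))
    have s : shift (Pi.single i 1 + Pi.single j 1) (hd K i j) = hd K i j := by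
      simp [shift_hd, hij.ne, hij.ne']
    rw [map_mul (shift _), shift_inverse _ u0, map_add, map_one, s] at w
    rw [l1, l2, ← mul_assoc, w, mul_assoc (X i * X j), ← map_mul]
    congr 2
    have h1 := shift_psi'_of_lt (K := K) hij
    have pj' := pj.map (shift (Pi.single i 1))
    have e0 := Ring.inverse_mul_cancel _ u0
    have e1 := Ring.inverse_mul_cancel _ pj
    have e2 := Ring.inverse_mul_cancel _ pj'
    rw [hd_neg i j] at h1
    refine pj.mul_left_cancel (pj'.mul_left_cancel (u0.mul_left_cancel ?_))
    generalize Ring.inverse (psi' K j) = b at *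
    generalize Ring.inverse (psi' K i) = c at *
    generalize Ring.inverse (hd K i j) = g at *
    generalize Ring.inverse (shift (Pi.single i 1) (psi' K j)) = b' at *
    linear_combination (shift (Pi.single i 1) (psi' K j)) * hd K i j * c * e1
      - psi' K j * (hd K i j + 1) * hd K i j * g * c * e2
      - psi' K j * (hd K i j + 1) * c * e0 - c * h1
  weight_Γ i := by
    intro u
    rw [shift_zero]
    refine Commute.sub_right (Commute.sum_right _ _ _ fun m _ => ?_) (ι_commute ι _ _)
    exact (ι_commute ι _ _).mul_right (haι m u).symm
  comm_Γ i j := by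
    have h1 : ∀ (m : Fin n) (j : Fin n), Commute (a m) (gamOf ι a j) := fun m j =>
      Commute.sub_right (Commute.sum_right _ _ _ fun m' _ => (haι m _).mul_right (ha m m'))
        (haι m _)
    have h2 : ∀ (u : Ubar K n) (j : Fin n), Commute (ι u) (gamOf ι a j) := fun u j =>
      Commute.sub_right (Commute.sum_right _ _ _ fun m' _ =>
        (ι_commute ι _ _).mul_right (haι m' u).symm) (ι_commute ι _ _)
    exact Commute.sub_left (Commute.sum_left _ _ _ fun m _ => (h2 _ j).mul_left (h1 m j)) (h2 _ j)
  x_Γ j k hkj := by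
    have w := (t.weight j).mul (hasWeight_coeff (ι := ι) (Ring.inverse (psi' K j)))
    rw [add_zero] at w
    exact mul_gamOf_of_ne hkj w a fun i => (haX i j).mul_right (haι i _)
  x_Γ_self j := by
    have w := (t.weight j).mul (hasWeight_coeff (ι := ι) (Ring.inverse (psi' K j)))
    rw [add_zero] at w
    exact mul_gamOf_self w a fun i => (haX i j).mul_right (haι i _)

/-- One half of the matrix inversion; it shows that the inverse map sends `c_{m+1}` to `a_{m+1}`. -/
theorem coeffs_gamOf (a : Fin n → A) (m : Fin n) :
    ∑ k, ι ((genPolyErase (K := K) k).coeff (n - (m + 1))) * gamOf ι a k -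
      ι ((genPoly K n).coeff (n - (m + 1))) = a m := by
  have e : ∀ k, ι ((genPolyErase (K := K) k).coeff (n - (m + 1))) * gamOf ι a k =
      ∑ m' : Fin n, ι (lagCoeff k (n - (m' + 1)) *
        (genPolyErase (K := K) k).coeff (n - (m + 1))) * a m' -
      ι (lagCoeff k n * (genPolyErase (K := K) k).coeff (n - (m + 1))) := by
    intro k
    rw [gamOf, mul_sub, Finset.mul_sum, ← map_mul]
    simp only [← mul_assoc, ← map_mul, mul_comm]
  simp only [e, Finset.sum_sub_distrib]
  rw [Finset.sum_comm, ← map_sum, sum_lagCoeff_mul_coeff _ le_rfl]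
  have hm := m.2
  have e2 : ∀ m' : Fin n, ∑ k, ι (lagCoeff k (n - (m' + 1)) *
      (genPolyErase (K := K) k).coeff (n - (m + 1))) * a m' = if m' = m then a m else 0 := by
    intro m'
    have hm' := m'.2
    rw [← Finset.sum_mul, ← map_sum, sum_lagCoeff_mul_coeff _ (by omega),
      if_neg (by omega : ¬ n - (m' + 1) = n), sub_zero]
    by_cases hmm : m' = m
    · subst hmm; simp
    · have : (m' : ℕ) ≠ m := fun h => hmm (Fin.ext h)
      rw [if_neg (by omega), if_neg hmm, map_zero, zero_mul]
  simp only [e2]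
  rw [Finset.sum_ite_eq', if_pos (Finset.mem_univ m), if_neg (by omega)]
  simp

/-- The other half, recovering the `Γ_k` from the central elements. The constant terms cancel
because `-h̃_k` is a root of the monic polynomial `∏ (z + h̃_i)`. -/
theorem gamOf_coeffs (G : Fin n → A) (k : Fin n) :
    gamOf ι (fun m => ∑ l, ι ((genPolyErase (K := K) l).coeff (n - (m + 1))) * G l -
      ι ((genPoly K n).coeff (n - (m + 1)))) k = G k := by
  rw [gamOf]
  have e : ∀ m : Fin n, ι (lagCoeff k (n - (m + 1))) *
      (∑ l, ι ((genPolyErase (K := K) l).coeff (n - (m + 1))) * G l -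
        ι ((genPoly K n).coeff (n - (m + 1)))) =
      ∑ l, ι (lagCoeff k (n - (m + 1)) * (genPolyErase (K := K) l).coeff (n - (m + 1))) * G l -
        ι (lagCoeff k (n - (m + 1)) * (genPoly K n).coeff (n - (m + 1))) := by
    intro m
    rw [mul_sub, Finset.mul_sum, ← map_mul]
    simp only [← mul_assoc, ← map_mul]
  simp only [e, Finset.sum_sub_distrib]
  rw [Finset.sum_comm, ← map_sum,
    sum_fin_reflect fun r => lagCoeff k r * (genPoly K n).coeff r, sum_lagCoeff_mul_coeff_genPoly]
  have e2 : ∀ l, ∑ m : Fin n, ι (lagCoeff k (n - (m + 1)) *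
      (genPolyErase (K := K) l).coeff (n - (m + 1))) * G l = if l = k then G k else 0 := by
    intro l
    rw [← Finset.sum_mul, ← map_sum,
      sum_fin_reflect fun r => lagCoeff k r * (genPolyErase (K := K) l).coeff r,
      sum_lagCoeff_mul_coeff_erase]
    split_ifs with h
    · rw [h, map_one, one_mul]
    · rw [map_zero, zero_mul]
  simp only [e2]
  rw [Finset.sum_ite_eq', if_pos (Finset.mem_univ k), map_neg]
  abel

end Reconstruct

/-! ### The isomorphism of localizations -/

section Iso

variable {K : Type*} [Field K] {n : ℕ}

theorem TorusData.map {A A' : Type*} [Ring A] [Algebra K A] [Ring A'] [Algebra K A']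
    {ι : Ubar K n →ₐ[K] A} {X Y : Fin n → A} (t : TorusData ι X Y) (f : A →ₐ[K] A') :
    TorusData (f.comp ι) (fun i => f (X i)) (fun i => f (Y i)) where
  weight i u := by
    rw [AlgHom.comp_apply, ← map_mul, t.weight i u, map_mul, AlgHom.comp_apply]
  mul_inv i := by rw [← map_mul, t.mul_inv, map_one]
  inv_mul i := by rw [← map_mul, t.inv_mul, map_one]
  comm i j := by rw [← map_mul, t.comm, map_mul]

/-! ### The torus inside the localization of `Diff_h(n)` -/

section DiffSide

variable [OreLocalization.OreSet (S K n)]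

variable (K n) in
/-- `Ū(n) → S_n⁻¹ Diff_h(n)`. -/
noncomputable def locU : Ubar K n →ₐ[K] OreLocalization (S K n) (Diff K n) :=
  (numHom K (S K n)).comp (ofUHom K n)

theorem locU_apply (u : Ubar K n) : locU K n u = numHom K (S K n) (ofU u) := rfl

theorem hasWeight_locU {w : Fin n → ℤ} {a : Diff K n} (ha : HasWeight (ofUHom K n) w a) :
    HasWeight (locU K n) w (numHom K (S K n) a) := fun u => by
  rw [locU_apply, locU_apply, ← map_mul, ← map_mul]
  exact congrArg _ (ha u)

/-- The inverse of `x^i`. -/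
noncomputable def xInv (K : Type*) [Field K] {n : ℕ} [OreLocalization.OreSet (S K n)] (i : Fin n) :
    OreLocalization (S K n) (Diff K n) := (1 : Diff K n) /ₒ (⟨x K i, x_mem_S K i⟩ : S K n)

theorem x_mul_xInv (i : Fin n) : numHom K (S K n) (x K i) * xInv K i = 1 :=
  numHom_mul_one_div (K := K) (⟨x K i, x_mem_S K i⟩ : S K n)

theorem xInv_mul_x (i : Fin n) : xInv K i * numHom K (S K n) (x K i) = 1 :=
  one_div_mul_numHom (K := K) (⟨x K i, x_mem_S K i⟩ : S K n)

theorem locU_inverse_psi' (i : Fin n) : locU K n (Ring.inverse (psi' K i)) =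
    (1 : Diff K n) /ₒ (⟨ofU (psi' K i), ofU_psi'_mem_S K i⟩ : S K n) := by
  refine left_inv_eq_right_inv (a := locU K n (psi' K i)) ?_
    (numHom_mul_one_div (K := K) (⟨ofU (psi' K i), ofU_psi'_mem_S K i⟩ : S K n))
  rw [← map_mul, Ring.inverse_mul_cancel _ (isUnit_psi' i), map_one]

theorem torusData_diff : TorusData (locU K n)
    (fun i => numHom K (S K n) (x K i * ofU (psi' K i)))
    (fun i => locU K n (Ring.inverse (psi' K i)) * xInv K i) where
  weight i := by
    have := hasWeight_locU ((hasWeight_x (K := K) i).mul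
      (hasWeight_coeff (ι := ofUHom K n) (psi' K i)))
    rwa [add_zero] at this
  mul_inv i := by
    rw [map_mul, ← locU_apply, mul_assoc, ← mul_assoc (locU K n _), ← map_mul,
      Ring.mul_inverse_cancel _ (isUnit_psi' i), map_one, one_mul, x_mul_xInv]
  inv_mul i := by
    rw [map_mul, ← locU_apply, mul_assoc, ← mul_assoc (xInv K i), xInv_mul_x, one_mul, ← map_mul,
      Ring.inverse_mul_cancel _ (isUnit_psi' i), map_one]
  comm := by
    have key : ∀ i j : Fin n, i < j → x K i * ofU (psi' K i) * (x K j * ofU (psi' K j)) =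
        x K j * ofU (psi' K j) * (x K i * ofU (psi' K i)) := by
      intro i j hij
      have u0 := isUnit_hd (K := K) hij.ne
      have e0 := Ring.inverse_mul_cancel _ u0
      have h1 := shift_psi'_of_lt (K := K) hij
      have w := ((hasWeight_x (K := K) j).mul (hasWeight_x i))
        ((hd K i j + 1) * Ring.inverse (hd K i j))
      have s : shift (Pi.single j 1 + Pi.single i 1) (hd K i j) = hd K i j := by
        simp [shift_hd, hij.ne, hij.ne']
      rw [map_mul (shift _), shift_inverse _ u0, map_add, map_one, s, ofUHom_apply] at w
      have l1 : x K i * ofU (psi' K i) * (x K j * ofU (psi' K j)) =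
          x K j * x K i *
            ofU ((hd K i j + 1) * Ring.inverse (hd K i j) * (psi' K i * psi' K j)) := by
        rw [mul_assoc, ← mul_assoc (ofU _), ofU_mul_x, shift_psi' hij, mul_assoc (x K j),
          ← mul_assoc (x K i), x_mul_x hij, w, mul_assoc (x K j * x K i), ← ofU_mul, ← ofU_mul]
      have l2 : x K j * ofU (psi' K j) * (x K i * ofU (psi' K i)) =
          x K j * x K i * ofU (shift (Pi.single i 1) (psi' K j) * psi' K i) := by
        rw [mul_assoc, ← mul_assoc (ofU _), ofU_mul_x, ofU_mul]
        simp only [mul_assoc]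
      rw [l1, l2]
      congr 2
      rw [hd_neg i j] at h1
      refine u0.mul_left_cancel ?_
      linear_combination (hd K i j + 1) * psi' K i * psi' K j * e0 + psi' K i * h1
    intro i j
    rw [← map_mul, ← map_mul]
    rcases lt_trichotomy i j with hij | rfl | hij
    · rw [key i j hij]
    · rfl
    · rw [key j i hij]

/-- Moving `h̃_i` past `(x^i)⁻¹` lowers it by one. This reconciles the image `X_i⁻¹ (h̃_i - 1)` of
`D_i` with the form required in the theorem. -/
theorem locU_h_sub_one (i : Fin n) :
    locU K n (Ring.inverse (psi' K i)) * xInv K i * locU K n (h K i - 1) =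
      locU K n (Ring.inverse (psi' K i)) * locU K n (h K i) * xInv K i := by
  have w := (hasWeight_locU (hasWeight_x (K := K) i)).of_isUnit (x_mul_xInv i) (xInv_mul_x i)
  have := w (h K i)
  rw [← Pi.single_neg, shift_h, Pi.single_eq_same, Int.cast_neg, Int.cast_one,
    ← sub_eq_add_neg] at this
  rw [mul_assoc, mul_assoc, this]

end DiffSide

/-! ### The torus inside the localized Weyl algebra -/

section WeylSide

variable [OreLocalization.OreSet (T K n)]

/-- The inverse of `X^i`. -/
noncomputable def WXInv (K : Type*) [Field K] {n : ℕ} [OreLocalization.OreSet (T K n)]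
    (i : Fin n) : OreLocalization (T K n) (Weyl K n) :=
  (1 : Weyl K n) /ₒ (⟨WX K i, WX_mem_T i⟩ : T K n)

theorem WX_mul_WXInv (i : Fin n) : numHom K (T K n) (WX K i) * WXInv K i = 1 :=
  numHom_mul_one_div (K := K) (⟨WX K i, WX_mem_T i⟩ : T K n)

theorem WXInv_mul_WX (i : Fin n) : WXInv K i * numHom K (T K n) (WX K i) = 1 :=
  one_div_mul_numHom (K := K) (⟨WX K i, WX_mem_T i⟩ : T K n)

theorem euler_commute (i j : Fin n) : Commute (euler K i) (euler K j) := by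
  have h1 : euler K i * euler K j =
      WX K j * (euler K i + if i = j then 1 else 0) * WD K j := by
    rw [← euler_mul_WX, mul_assoc]; rfl
  have h2 : (euler K i + if i = j then 1 else 0) * WD K j = WD K j * euler K i := by
    rw [add_mul, euler_mul_WD, mul_sub]
    split_ifs <;> simp
  rw [Commute, SemiconjBy, h1, mul_assoc, h2, ← mul_assoc]; rfl

theorem isUnit_numHom {R : Type*} [Ring R] [Algebra K R] {M : Submonoid R}
    [OreLocalization.OreSet M] {s : R} (hs : s ∈ M) : IsUnit (numHom K M s) :=
  isUnit_of_inverse (numHom_mul_one_div (K := K) (⟨s, hs⟩ : M)) (one_div_mul_numHom ⟨s, hs⟩)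

theorem isUnit_map_sub_add_swap {R A : Type*} [Ring R] [Algebra K R] [Ring A] [Algebra K A]
    (f : R →ₐ[K] A) (a b : R) (k : ℤ) (hu : IsUnit (f (b - a + ((-k : ℤ) : R)))) :
    IsUnit (f (a - b + k)) := by
  have e : a - b + (k : R) = -(b - a + ((-k : ℤ) : R)) := by push_cast; abel
  rw [e, map_neg]
  exact hu.neg

/-- The image of `h̃_i` is `X^i D_i + 1`, so that `D_i` is recovered as `(X^i)⁻¹ (h̃_i - 1)`. The
constants cancel in differences, hence the `h̃_{ij} + k` go, up to sign, to generators of `T`. -/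
theorem exists_torusData_weyl : ∃ ι : Ubar K n →ₐ[K] OreLocalization (T K n) (Weyl K n),
    (∀ i, ι (h K i) = numHom K (T K n) (euler K i + 1)) ∧
      TorusData ι (fun i => numHom K (T K n) (WX K i)) (fun i => WXInv K i) := by
  obtain ⟨ι, hι⟩ := exists_ubarLift (K := K)
    (fun i : Fin n => numHom K (T K n) (euler K i + 1)) (fun i j => by
      have : Commute (euler K i + 1) (euler K j + 1) :=
        ((euler_commute i j).add_right (Commute.one_right _)).add_left (Commute.one_left _)
      exact this.map (numHom K (T K n))) (fun i j k hij => by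
      have e : numHom K (T K n) (euler K i + 1) - numHom K (T K n) (euler K j + 1) + k =
          numHom K (T K n) (euler K i - euler K j + (k : Weyl K n)) := by
        simp only [map_add, map_sub, map_one, map_intCast]
        abel
      rw [e]
      rcases lt_or_gt_of_ne hij with hij | hij
      · exact isUnit_numHom (mem_T hij k)
      · exact isUnit_map_sub_add_swap (R := Weyl K n)
          (A := OreLocalization (T K n) (Weyl K n)) (numHom K (T K n)) (euler K i) (euler K j) k
          (isUnit_numHom (K := K) (mem_T (K := K) hij (-k))))
  refine ⟨ι, hι, fun i => hasWeight_of_h fun j => ?_, WX_mul_WXInv, WXInv_mul_WX, fun i j => ?_⟩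
  · have e : ι ((Pi.single i 1 : Fin n → ℤ) j) =
        numHom K (T K n) (if j = i then 1 else 0) := by
      rw [Pi.single_apply, map_intCast]
      split_ifs <;> simp
    rw [map_add, e, hι, ← map_mul, add_mul, euler_mul_WX, ← map_add, ← map_mul, one_mul]
    congr 1
    simp only [mul_add, mul_one]
    abel
  · rw [← map_mul, ← map_mul, WX_mul_WX]

end WeylSide

theorem commute_of_numHom {R A : Type*} [Ring R] [Algebra K R] [Ring A] [Algebra K A]
    {M : Submonoid R} [OreLocalization.OreSet M] (g : OreLocalization M R →ₐ[K] A) (z : A)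
    (hz : ∀ r, Commute z (g (numHom K M r))) (w : OreLocalization M R) : Commute z (g w) := by
  induction w using OreLocalization.ind with | _ r s
  have e : numHom K M (s : R) * (r /ₒ s) = numHom K M r :=
    OreLocalization.mul_cancel (s := s) (t := 1)
  have hu : IsUnit (g (numHom K M (s : R))) := (isUnit_numHom s.2).map g
  refine hu.mul_left_cancel ?_
  rw [← mul_assoc, ← (hz s).eq, mul_assoc, ← map_mul, e, (hz r).eq, ← mul_assoc, ← map_mul, e]

theorem c_succ_eq (m : Fin n) : c K n (m + 1) =
    ∑ k, ofU ((genPolyErase (K := K) k).coeff (n - (m + 1))) * Gam K k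
      - ofU ((genPoly K n).coeff (n - (m + 1))) := c_eq m.2

/-! ### The map `μ`, its inverse, and the comparison on generators -/

section

variable [OreLocalization.OreSet (S K n)] [OreLocalization.OreSet (T K n)]

/-- The homomorphism `μ`. -/
theorem exists_mu : ∃ μ : (MvPolynomial (Fin n) K ⊗[K] OreLocalization (T K n) (Weyl K n)) →ₐ[K]
      OreLocalization (S K n) (Diff K n),
    (∀ i, μ (1 ⊗ₜ[K] numHom K (T K n) (WX K i)) =
      numHom K (S K n) (x K i * ofU (psi' K i))) ∧
    (∀ i, μ (1 ⊗ₜ[K] numHom K (T K n) (WD K i)) =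
      locU K n (Ring.inverse (psi' K i)) * xInv K i * locU K n (h K i - 1)) ∧
    ∀ i : Fin n, μ (MvPolynomial.X i ⊗ₜ[K] 1) = numHom K (S K n) (c K n (i + 1)) := by
  have t := torusData_diff (K := K) (n := n)
  obtain ⟨f, fX, fD⟩ := t.exists_weylHom
  -- Since `X^i D_i` goes to `h̃_i - 1`, the generators of `T` other than the `X^j` go to the units
  -- `h̃_{jk} + ℓ`.
  have fe : ∀ i, f (WX K i * WD K i) = locU K n (h K i - 1) := fun i => by
    rw [map_mul, fX, fD, ← mul_assoc, t.mul_inv, one_mul]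
  have hf : ∀ s ∈ T K n, IsUnit (f s) := fun s hs => by
    induction hs using Submonoid.closure_induction with
    | mem s hs =>
      obtain ⟨j, rfl⟩ | ⟨j, k, l, hjk, rfl⟩ := hs
      · rw [fX]; exact isUnit_of_inverse (t.mul_inv j) (t.inv_mul j)
      · have : f (WX K j * WD K j - WX K k * WD K k + (l : Weyl K n)) =
            locU K n (hd K j k + (l : Ubar K n)) := by
          have e : hd K j k + (l : Ubar K n) = (h K j - 1) - (h K k - 1) + (l : Ubar K n) := by
            rw [hd]; ring
          rw [e, map_add, map_sub, fe, fe, map_intCast, map_add, map_sub (locU K n) (h K j - 1),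
            map_intCast]
        rw [this]
        exact (isUnit_hd_add K hjk.ne l).map _
    | one => rw [map_one]; exact isUnit_one
    | mul a b _ _ ha hb => rw [map_mul]; exact ha.mul hb
  obtain ⟨g, hg⟩ := exists_oreLift (K := K) (R := Weyl K n)
    (A := OreLocalization (S K n) (Diff K n)) (M := T K n) f hf
  obtain ⟨p, hp⟩ := exists_polyLift (K := K)
    (fun i : Fin n => numHom K (S K n) (c K n (i + 1))) fun i j =>
      (c_commute_c _ _).map (numHom K (S K n))
  have cu : ∀ (i : Fin n) u, Commute (numHom K (S K n) (c K n (i + 1))) (locU K n u) :=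
    fun i u => ((c_commute_ofU _ u).map (numHom K (S K n))).symm
  have cx : ∀ i j : Fin n, Commute (numHom K (S K n) (c K n (i + 1)))
      (numHom K (S K n) (x K j)) :=
    fun i j => ((c_commute_x i.2 j).map (numHom K (S K n))).symm
  have cg : ∀ (i : Fin n) w, Commute (numHom K (S K n) (c K n (i + 1))) (g w) := by
    intro i w
    refine commute_of_numHom (K := K) (R := Weyl K n)
      (A := OreLocalization (S K n) (Diff K n)) (M := T K n) g _ (fun r => ?_) w
    rw [hg]
    induction r using weyl_induction with
    | hk k => rw [AlgHom.commutes]; exact (Algebra.commutes k _).symm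
    | hX j => rw [fX, map_mul]; exact (cx i j).mul_right (cu i _)
    | hD j =>
      rw [fD]
      refine Commute.mul_right (Commute.mul_right (cu i _) ?_) (cu i _)
      exact (commute_of_inverse (A := OreLocalization (S K n) (Diff K n))
        (x_mul_xInv j) (xInv_mul_x j) (cx i j).symm).symm
    | hmul a b ha hb => rw [map_mul]; exact ha.mul_right hb
    | hadd a b ha hb => rw [map_add]; exact ha.add_right hb
  refine ⟨Algebra.TensorProduct.lift p g fun q w =>
    mvPolynomial_commute (A := OreLocalization (S K n) (Diff K n)) p (g w) (fun i => by rw [hp]; exact cg i w) q, fun i => ?_, fun i => ?_,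
    fun i => ?_⟩
  · rw [Algebra.TensorProduct.lift_tmul, map_one, one_mul, hg, fX]
  · rw [Algebra.TensorProduct.lift_tmul, map_one, one_mul, hg, fD]
  · rw [Algebra.TensorProduct.lift_tmul, map_one, mul_one, hp]

/-- The inverse of `μ`. -/
theorem exists_mu_symm : ∃ ν : OreLocalization (S K n) (Diff K n) →ₐ[K]
      (MvPolynomial (Fin n) K ⊗[K] OreLocalization (T K n) (Weyl K n)),
    (∀ i, ν (locU K n (h K i)) = 1 ⊗ₜ[K] numHom K (T K n) (euler K i + 1)) ∧
    (∀ i, ν (numHom K (S K n) (x K i * ofU (psi' K i))) =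
      1 ⊗ₜ[K] numHom K (T K n) (WX K i)) ∧
    (∀ k, ν (numHom K (S K n) (Gam K k)) = gamOf (ν.comp (locU K n))
      (fun i => MvPolynomial.X i ⊗ₜ[K] 1) k) := by
  obtain ⟨ι₀, hι₀, t₀⟩ := exists_torusData_weyl (K := K) (n := n)
  let inc : OreLocalization (T K n) (Weyl K n) →ₐ[K]
      (MvPolynomial (Fin n) K ⊗[K] OreLocalization (T K n) (Weyl K n)) :=
    Algebra.TensorProduct.includeRight
  have t := t₀.map inc
  set ι := inc.comp ι₀
  let a : Fin n → (MvPolynomial (Fin n) K ⊗[K] OreLocalization (T K n) (Weyl K n)) :=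
    fun i => MvPolynomial.X i ⊗ₜ[K] 1
  have hainc : ∀ i w, Commute (a i) (inc w) := fun i w => by
    change (MvPolynomial.X i ⊗ₜ[K] (1 : OreLocalization (T K n) (Weyl K n))) *
      ((1 : MvPolynomial (Fin n) K) ⊗ₜ[K] w) = ((1 : MvPolynomial (Fin n) K) ⊗ₜ[K] w) *
      (MvPolynomial.X i ⊗ₜ[K] (1 : OreLocalization (T K n) (Weyl K n)))
    rw [Algebra.TensorProduct.tmul_mul_tmul, Algebra.TensorProduct.tmul_mul_tmul]
    simp only [mul_one, one_mul]
  have haa : ∀ i j, Commute (a i) (a j) := fun i j => by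
    change (MvPolynomial.X i ⊗ₜ[K] (1 : OreLocalization (T K n) (Weyl K n))) *
      (MvPolynomial.X j ⊗ₜ[K] 1) = (MvPolynomial.X j ⊗ₜ[K] 1) * (MvPolynomial.X i ⊗ₜ[K] 1)
    rw [Algebra.TensorProduct.tmul_mul_tmul, Algebra.TensorProduct.tmul_mul_tmul,
      mul_comm (MvPolynomial.X i)]
  -- The polynomial variables commute with the torus, so the interpolation formula turns them into
  -- elements satisfying the relations of the `Γ_k`.
  have hd := t.hDiffData a haa (fun i u => hainc i _) (fun i j => hainc i _)
  obtain ⟨f, fu, fx, fd⟩ := hd.exists_diffHom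
  obtain ⟨ν, hν⟩ := exists_oreLift (M := S K n) f fun s hs => by
    induction hs using Submonoid.closure_induction with
    | mem s hs =>
      obtain ⟨j, rfl⟩ | ⟨i, j, k, hij, rfl⟩ := hs
      · rw [fx]; exact isUnit_of_inverse (hd.mul_inv j) (hd.inv_mul j)
      · rw [fu]; exact (isUnit_hd_add K hij k).map _
    | one => rw [map_one]; exact isUnit_one
    | mul a b _ _ ha hb => rw [map_mul]; exact ha.mul hb
  have hνι : ν.comp (locU K n) = ι := AlgHom.ext fun u => (hν _).trans (fu u)
  refine ⟨ν, fun i => ?_, fun i => ?_, fun k => ?_⟩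
  · rw [locU_apply, hν, fu]
    exact congrArg inc (hι₀ i)
  · rw [hν, map_mul, fx, fu, mul_assoc, ← map_mul, Ring.inverse_mul_cancel _ (isUnit_psi' i),
      map_one, mul_one]
    rfl
  · rw [hν, hνι, Gam, map_mul, fx, fd, mul_assoc, hd.inv_mul, mul_one]

theorem diffHom_ext {A : Type*} [Ring A] [Algebra K A] {f g : Diff K n →ₐ[K] A}
    (hu : ∀ i, f (ofU (h K i)) = g (ofU (h K i))) (hx : ∀ i, f (x K i) = g (x K i))
    (hd : ∀ i, f (d K i) = g (d K i)) : f = g := by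
  have hu' : f.comp (ofUHom K n) = g.comp (ofUHom K n) := ubar_algHom_ext hu
  refine AlgHom.ext fun r => ?_
  induction r using diff_induction with
  | hu u => exact congrArg (fun φ => φ u) hu'
  | hx i => exact hx i
  | hd i => exact hd i
  | hmul a b ha hb => rw [map_mul, map_mul, ha, hb]
  | hadd a b ha hb => rw [map_add, map_add, ha, hb]

theorem weylHom_ext {A : Type*} [Ring A] [Algebra K A] {f g : Weyl K n →ₐ[K] A}
    (hX : ∀ i, f (WX K i) = g (WX K i)) (hD : ∀ i, f (WD K i) = g (WD K i)) : f = g := by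
  refine AlgHom.ext fun r => ?_
  induction r using weyl_induction with
  | hk k => rw [AlgHom.commutes, AlgHom.commutes]
  | hX i => exact hX i
  | hD i => exact hD i
  | hmul a b ha hb => rw [map_mul, map_mul, ha, hb]
  | hadd a b ha hb => rw [map_add, map_add, ha, hb]

theorem map_gamOf {A A' : Type*} [Ring A] [Algebra K A] [Ring A'] [Algebra K A']
    (ι : Ubar K n →ₐ[K] A) (f : A →ₐ[K] A') (a : Fin n → A) (k : Fin n) :
    f (gamOf ι a k) = gamOf (f.comp ι) (fun i => f (a i)) k := by
  simp only [gamOf, map_sub, map_sum, map_mul, AlgHom.comp_apply]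

/-- The composites are checked on generators: the torus parts match by construction, and the `Γ_k`
and `a_i` by `gamOf_coeffs` and `coeffs_gamOf`. -/
theorem exists_equiv : ∃ μ : (MvPolynomial (Fin n) K ⊗[K] OreLocalization (T K n) (Weyl K n)) ≃ₐ[K]
      OreLocalization (S K n) (Diff K n),
    (∀ i, μ (1 ⊗ₜ[K] numHom K (T K n) (WX K i)) =
      numHom K (S K n) (x K i * ofU (psi' K i))) ∧
    (∀ i, μ (1 ⊗ₜ[K] numHom K (T K n) (WD K i)) =
      locU K n (Ring.inverse (psi' K i)) * xInv K i * locU K n (h K i - 1)) ∧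
    ∀ i : Fin n, μ (MvPolynomial.X i ⊗ₜ[K] 1) = numHom K (S K n) (c K n (i + 1)) := by
  obtain ⟨μ, μX, μD, μa⟩ := exists_mu (K := K) (n := n)
  obtain ⟨ν, νh, νX, νG⟩ := exists_mu_symm (K := K) (n := n)
  have t := torusData_diff (K := K) (n := n)
  have tmul : ∀ w w' : Weyl K n, ((1 : MvPolynomial (Fin n) K) ⊗ₜ[K] numHom K (T K n) (w * w')) =
      (1 ⊗ₜ[K] numHom K (T K n) w) * (1 ⊗ₜ[K] numHom K (T K n) w') := fun w w' => by
    rw [Algebra.TensorProduct.tmul_mul_tmul, one_mul, map_mul]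
  have tadd1 : ∀ w : Weyl K n, ((1 : MvPolynomial (Fin n) K) ⊗ₜ[K] numHom K (T K n) (w + 1)) =
      (1 ⊗ₜ[K] numHom K (T K n) w) + 1 := fun w => by
    rw [map_add, map_one, TensorProduct.tmul_add]; rfl
  have μE : ∀ i, μ (1 ⊗ₜ[K] numHom K (T K n) (euler K i + 1)) = locU K n (h K i) := fun i => by
    rw [tadd1, euler, tmul, map_add, map_mul, μX, μD, ← mul_assoc, t.mul_inv, one_mul, map_one,
      map_sub, map_one, sub_add_cancel]
  have μνι : (μ.comp ν).comp (locU K n) = locU K n := ubar_algHom_ext fun i => by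
    simp only [AlgHom.comp_apply]
    rw [νh, μE]
  have μνu : ∀ u, μ (ν (locU K n u)) = locU K n u := fun u => congrArg (fun φ => φ u) μνι
  have right : μ.comp ν = AlgHom.id K _ := by
    refine oreHom_ext (K := K) (R := Diff K n) (A := OreLocalization (S K n) (Diff K n))
      (M := S K n) fun r => ?_
    have μνx : ∀ i, μ (ν (numHom K (S K n) (x K i))) = numHom K (S K n) (x K i) := fun i => by
      have e : numHom K (S K n) (x K i) = numHom K (S K n) (x K i * ofU (psi' K i)) *
          locU K n (Ring.inverse (psi' K i)) := by
        rw [map_mul, ← locU_apply, mul_assoc, ← map_mul,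
          Ring.mul_inverse_cancel _ (isUnit_psi' i), map_one, mul_one]
      rw [e, map_mul, map_mul, μνu, νX, μX]
    have μνG : ∀ k, μ (ν (numHom K (S K n) (Gam K k))) = numHom K (S K n) (Gam K k) := fun k => by
      rw [νG]
      refine (map_gamOf (A' := OreLocalization (S K n) (Diff K n))
        (A := MvPolynomial (Fin n) K ⊗[K] OreLocalization (T K n) (Weyl K n))
        (ν.comp (locU K n)) μ (fun i => MvPolynomial.X i ⊗ₜ[K] 1) k).trans ?_
      rw [← AlgHom.comp_assoc, μνι]
      simp only [μa, c_succ_eq, map_sub, map_sum, map_mul, ← locU_apply]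
      exact gamOf_coeffs (fun k => numHom K (S K n) (Gam K k)) k
    have : (μ.comp ν).comp (numHom K (S K n)) = (AlgHom.id K _).comp (numHom K (S K n)) := by
      refine diffHom_ext (K := K) (n := n) (A := OreLocalization (S K n) (Diff K n))
        (f := (μ.comp ν).comp (numHom K (S K n)))
        (g := (AlgHom.id K _).comp (numHom K (S K n))) (fun i => μνu _) μνx fun i => ?_
      -- The case of `∂̄_i` follows from that of `Γ_i = ∂̄_i x^i` on cancelling the unit `x^i`.
      have hu : IsUnit (numHom K (S K n) (x K i)) := isUnit_numHom (x_mem_S K i)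
      refine hu.mul_right_cancel ?_
      have := μνG i
      rw [Gam, map_mul, map_mul, map_mul, μνx] at this
      exact this
    exact congrArg (fun φ => φ r) this
  have left : ν.comp μ = AlgHom.id K _ := by
    refine Algebra.TensorProduct.ext ?_ ?_
    · refine MvPolynomial.algHom_ext fun i => ?_
      change ν (μ (MvPolynomial.X i ⊗ₜ[K] 1)) = MvPolynomial.X i ⊗ₜ[K] 1
      rw [μa, c_succ_eq]
      simp only [map_sub, map_sum, map_mul, ← locU_apply, νG]
      exact coeffs_gamOf (ι := ν.comp (locU K n)) _ i
    · refine oreHom_ext fun r => ?_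
      have νμX : ∀ i, ν (μ (1 ⊗ₜ[K] numHom K (T K n) (WX K i))) =
          1 ⊗ₜ[K] numHom K (T K n) (WX K i) := fun i => by rw [μX, νX]
      have : ((ν.comp μ).comp Algebra.TensorProduct.includeRight).comp (numHom K (T K n)) =
          (Algebra.TensorProduct.includeRight : _ →ₐ[K]
            (MvPolynomial (Fin n) K ⊗[K] OreLocalization (T K n) (Weyl K n))).comp
            (numHom K (T K n)) := by
        refine weylHom_ext νμX fun i => ?_
        change ν (μ (1 ⊗ₜ[K] numHom K (T K n) (WD K i))) = 1 ⊗ₜ[K] numHom K (T K n) (WD K i)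
        -- Likewise `D_i` is reached from `X^i D_i + 1`, the partner of `h̃_i`, on cancelling the
        -- unit `X^i`.
        have hu : IsUnit ((1 : MvPolynomial (Fin n) K) ⊗ₜ[K] numHom K (T K n) (WX K i)) :=
          (isUnit_numHom (K := K) (WX_mem_T i)).map
            (Algebra.TensorProduct.includeRight : _ →ₐ[K]
              (MvPolynomial (Fin n) K ⊗[K] OreLocalization (T K n) (Weyl K n)))
        refine hu.mul_left_cancel ?_
        have h1 := congrArg ν (μE i)
        rw [νh, tadd1, map_add, map_add, map_one, map_one, euler, tmul, map_mul, map_mul,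
          νμX] at h1
        exact add_right_cancel h1
      exact congrArg (fun φ => φ r) this
  exact ⟨AlgEquiv.ofAlgHom μ ν right left, μX, μD, μa⟩

end

end Iso

end HDeformed

theorem mainTheorem6 (K : Type*) [Field K] [IsAlgClosed K] [CharZero K] (n : ℕ) :
    -- `S_n` and `T` are left and right Ore sets
    (Nonempty (OreLocalization.OreSet (HDeformed.S K n)) ∧
      Nonempty (OreLocalization.OreSet (HDeformed.S K n).op)) ∧
    (Nonempty (OreLocalization.OreSet (HDeformed.T K n)) ∧
      Nonempty (OreLocalization.OreSet (HDeformed.T K n).op)) ∧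
    -- the explicit isomorphism between the localizations
    ∀ [OreLocalization.OreSet (HDeformed.S K n)] [OreLocalization.OreSet (HDeformed.T K n)],
      ∃ μ : (MvPolynomial (Fin n) K ⊗[K] OreLocalization (HDeformed.T K n) (HDeformed.Weyl K n))
          ≃ₐ[K] OreLocalization (HDeformed.S K n) (HDeformed.Diff K n),
        (∀ i : Fin n,
          μ (1 ⊗ₜ[K] (HDeformed.WX K i /ₒ (1 : HDeformed.T K n)))
            = (HDeformed.x K i * HDeformed.ofU (HDeformed.psi' K i)) /ₒ (1 : HDeformed.S K n)) ∧
        (∀ i : Fin n,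
          μ (1 ⊗ₜ[K] (HDeformed.WD K i /ₒ (1 : HDeformed.T K n)))
            = (1 /ₒ (⟨HDeformed.ofU (HDeformed.psi' K i), HDeformed.ofU_psi'_mem_S K i⟩ :
                  HDeformed.S K n))
              * (HDeformed.ofU (HDeformed.h K i) /ₒ (1 : HDeformed.S K n))
              * (1 /ₒ (⟨HDeformed.x K i, HDeformed.x_mem_S K i⟩ : HDeformed.S K n))) ∧
        (∀ i : Fin n,
          μ (MvPolynomial.X i ⊗ₜ[K] 1)
            = HDeformed.c K n ((i : ℕ) + 1) /ₒ (1 : HDeformed.S K n)) := by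
  refine ⟨⟨HDeformed.nonempty_oreSet_S, HDeformed.nonempty_oreSet_S_op⟩,
    ⟨HDeformed.nonempty_oreSet_T, HDeformed.nonempty_oreSet_T_op⟩, ?_⟩
  intro _ _
  obtain ⟨μ, μX, μD, μa⟩ := HDeformed.exists_equiv (K := K) (n := n)
  refine ⟨μ, μX, fun i => ?_, μa⟩
  have := μD i
  rw [HDeformed.locU_h_sub_one, HDeformed.locU_inverse_psi'] at this
  exact this
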